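/- Notation. $\mathcal H^s$ is the $s$-dimensional Hausdorff measure, $\dim$ the Hausdorff dimension, $\mathcal L^m$ Lebesgue (outer) measure, $B(x,r)$ the closed ball and $B^n(0,1)$ the closed unit ball of $\mathbb R^n$. $\mathcal M(S)$ is the set of non-zero finite Borel measures with compact support contained in $S$. For a finite Borel measure $\sigma$ on $\mathbb R^m$, $D(\sigma,u)=\lim_{\delta\to0}\sigma(B(u,\delta))/\mathcal L^m(B(u,\delta))$, which exists for $\mathcal L^m$ almost all $u$. The lower density is $\theta^s_*(A,x)=\liminf_{r\to0}(2r)^{-s}\mathcal H^s(A\cap B(x,r))$. Let $\Lambda$ be a compact metric space with a finite non-zero Borel measure $\omega$, and let $P_\lambda:\mathbb R^n\times\mathbb R^p\to\mathbb R^m$, $\lambda\in\Lambda$, be orthogonal projections (linear, with $P_\lambda P_\lambda^*=\mathrm{id}$) such that $\lambda\mapsto P_\lambda z$ is continuous for every $z\in\mathbb R^n\times\mathbb R^p$. Let $s,t>0$ with $s+t>m$. Suppose that there is a number $C>0$ such that, whenever $\mu\in\mathcal M(B^n(0,1))$ and $\nu\in\mathcal M(B^p(0,1))$ satisfy $\mu(B(x,r))\le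 r^s$ for all $x\in\mathbb R^n$, $r>0$, and $\nu(B(y,r))\le r^t$ for all $y\in\mathbb R^p$, $r>0$, we have $P_{\lambda\sharp}(\mu\times\nu)\ll\mathcal L^m$ for $\omega$ almost all $\lambda\in\Lambda$ and $$\iint D(P_{\lambda\sharp}(\mu\times\nu),u)^2\,d\mathcal L^m u\,d\omega\lambda<C.$$ Let $A\subset\mathbb R^n$ be $\mathcal H^s$ measurable with $0<\mathcal H^s(A)<\infty$, let $B\subset\mathbb R^p$ be $\mathcal H^t$ measurable with $0<\mathcal H^t(B)<\infty$, and suppose that $\theta^s_*(A,x)>0$ for $\mathcal H^s$ almost all $x\in A$ and $\theta^t_*(B,y)>0$ for $\mathcal H^t$ almost all $y\in B$. Let $$G=\{(x,y)\in A\times B:\ \theta^s_*(A,x)>0\ \text{or}\ \theta^t_*(B,y)>0\},$$ which is $A\times B$ up to an $\mathcal H^s\times\mathcal H^t$ null set. (1) For $\mathcal H^s\times\mathcal H^t\times\omega$ almost all $(x,y,\lambda)\in A\times B\times\Lambda$, $$\dim\big(P_\lambda^{-1}\{P_\lambda(x,y)\}\cap G\big)=s+t-m,$$ and for $\omega$ almost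 all $\lambda\in\Lambda$, $$\mathcal L^m\big(\{u\in\mathbb R^m:\dim (P_\lambda^{-1}\{u\}\cap G)=s+t-m\}\big)>0.$$ (2) In particular, for $\mathcal H^s\times\mathcal H^t\times\omega$ almost all $(x,y,\lambda)\in A\times B\times\Lambda$, $\dim (P_\lambda^{-1}\{P_\lambda(x,y)\}\cap(A\times B))\ge s+t-m$, and for $\omega$ almost all $\lambda\in\Lambda$, $\mathcal L^m(\{u:\dim (P_\lambda^{-1}\{u\}\cap(A\times B))\ge s+t-m\})>0$. (3) If $\theta^s_*(A,x)>0$ for every $x\in A$, or $\theta^t_*(B,y)>0$ for every $y\in B$ (so that $G=A\times B$), then for $\mathcal H^s\times\mathcal H^t\times\omega$ almost all $(x,y,\lambda)\in A\times B\times\Lambda$, $$\dim \big(P_\lambda^{-1}\{P_\lambda(x,y)\}\cap(A\times B)\big)=s+t-m,$$ and for $\omega$ almost all $\lambda\in\Lambda$, $$\mathcal L^m\big(\{u\in\mathbb R^m:\dim (P_\lambda^{-1}\{u\}\cap(A\times B))=s+t-m\}\big)>0.$$ -/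

import Mathlib

open MeasureTheory Measure Set Filter Topology
open scoped ENNReal

noncomputable section

/-- The Euclidean space `ℝⁿ × ℝᵖ`, with norm `|(x, y)|² = |x|² + |y|²`. -/
abbrev EuclProd (n p : ℕ) : Type :=
  WithLp 2 (EuclideanSpace ℝ (Fin n) × EuclideanSpace ℝ (Fin p))

/-- The product set `A × B`, as a subset of the Euclidean space `ℝⁿ × ℝᵖ`. -/
def prodSet {n p : ℕ} (A : Set (EuclideanSpace ℝ (Fin n))) (B : Set (EuclideanSpace ℝ (Fin p))) :
    Set (EuclProd n p) :=
  {z | z.fst ∈ A ∧ z.snd ∈ B}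

/-- `P` is an orthogonal projection onto `ℝᵐ`, i.e. an orthogonal projection onto an
`m`-dimensional subspace (the orthogonal complement of the kernel) followed by an isometric
identification of that subspace with `ℝᵐ`. -/
def IsOrthProj {n p m : ℕ} (P : EuclProd n p →L[ℝ] EuclideanSpace ℝ (Fin m)) : Prop :=
  P ∘L ContinuousLinearMap.adjoint P = ContinuousLinearMap.id ℝ (EuclideanSpace ℝ (Fin m))

/-- `μ ∈ 𝓜(S)`: a non-zero finite Borel measure on `ℝⁿ` with compact support contained in `S`. -/
structure IsCompactlySupportedIn {n : ℕ} (μ : Measure (EuclideanSpace ℝ (Fin n)))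
    (S : Set (EuclideanSpace ℝ (Fin n))) : Prop where
  ne_zero : μ ≠ 0
  finite : IsFiniteMeasure μ
  compact_support : IsCompact μ.support
  support_subset : μ.support ⊆ S

/-- The Frostman condition `μ(B(x,r)) ≤ r ^ s` for all `x` and all `r > 0` (closed balls). -/
def IsFrostman {n : ℕ} (μ : Measure (EuclideanSpace ℝ (Fin n))) (s : ℝ) : Prop :=
  ∀ x : EuclideanSpace ℝ (Fin n), ∀ r : ℝ, 0 < r →
    μ (Metric.closedBall x r) ≤ ENNReal.ofReal (r ^ s)

/-- The lower `s`-density `liminf_{r → 0} (2r)^{-s} ℋˢ(A ∩ B(x,r))`. -/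
def lowerDensity {n : ℕ} (s : ℝ) (A : Set (EuclideanSpace ℝ (Fin n)))
    (x : EuclideanSpace ℝ (Fin n)) : ℝ≥0∞ :=
  liminf (fun r : ℝ => μH[s] (A ∩ Metric.closedBall x r) / ENNReal.ofReal ((2 * r) ^ s)) (𝓝[>] 0)

/-- The derivative `D(ν,u) = lim_{δ → 0} ν(B(u,δ)) / ℒᵐ(B(u,δ))`. It is written as an upper limit,
which equals the limit wherever the latter exists (for a finite measure: almost everywhere). -/
def ballDeriv {m : ℕ} (ν : Measure (EuclideanSpace ℝ (Fin m)))
    (u : EuclideanSpace ℝ (Fin m)) : ℝ≥0∞ :=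
  limsup (fun δ : ℝ => ν (Metric.closedBall u δ) / volume (Metric.closedBall u δ)) (𝓝[>] 0)

/-- The push-forward `P_♯(μ × ν)`. -/
def pushProd {n p m : ℕ} (P : EuclProd n p →L[ℝ] EuclideanSpace ℝ (Fin m))
    (μ : Measure (EuclideanSpace ℝ (Fin n))) (ν : Measure (EuclideanSpace ℝ (Fin p))) :
    Measure (EuclideanSpace ℝ (Fin m)) :=
  (μ.prod ν).map (fun z => P (WithLp.toLp 2 z))

/-- The points `(x, y)` of `A × B` such that `A` has positive lower `s`-density at `x` or
`B` has positive lower `t`-density at `y`. -/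
def posDensityPart {n p : ℕ} (s t : ℝ) (A : Set (EuclideanSpace ℝ (Fin n)))
    (B : Set (EuclideanSpace ℝ (Fin p))) : Set (EuclProd n p) :=
  {z ∈ prodSet A B | 0 < lowerDensity s A z.fst ∨ 0 < lowerDensity t B z.snd}

end

/-! Both bounds come from counting. If a part of `A` has mass at least c r^s in each small ball of
radius r centred on it, a maximal separated set shows that about r^(-s) balls of radius 2r cover it.

Upper bound. Combine these coverings with efficient coverings of `B`, which is null in every
dimension above t. The product of the two sets is then null in every dimension τ > s + t, although
nothing is known about covering numbers of `B`; the factors may be exchanged. A covering ball of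
radius r meets the fibre over u only for u in a ball of volume about r^m, so integration in (λ, u)
shows that almost all slices are (τ - m)-null (`ae_hausdorffMeasure_slice_eq_zero`).

Lower bound. Let M be the product of ℋˢ on a piece of `A` and ℋᵗ on a piece of `B`, both with
controlled densities, and disintegrate ω × M along (λ, P_λ z). The density of P_λ♯(M|Q) is that of
P_λ♯M times the conditional measure of Q (`ae_sliceDensity_restrict_eq`). For a box Q of size r,
rescaling to the unit ball turns the L² hypothesis into a bound of order r^(2(s+t)-m) for the
squared density (`lintegral_ballDeriv_sq_pushProd_restrict_le`). About r^(-s-t) boxes suffice, so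
the total is of order r^(s+t-m). Weighted by r^(-τ) it is summable over dyadic r when τ < s + t - m.
Thus almost all conditional measures have finite discrete τ-energy, and their fibres have dimension
at least τ (`le_dimH_of_tsum_measure_sq_ne_top`).

Absolute continuity of P_λ♯M carries null sets of (λ, u) back to null sets of (λ, z), and forces the
set of good u to have positive measure. -/

/-! ### Coverings by balls and Hausdorff null sets -/

/-- A set of zero `τ`-dimensional Hausdorff measure has coverings by small closed balls with
arbitrarily small `τ`-dimensional content. -/
theorem exists_closedBall_cover_of_hausdorffMeasure_eq_zero {X : Type*} [MetricSpace X]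
    [MeasurableSpace X] [BorelSpace X] [Nonempty X] {τ : ℝ} (hτ : 0 < τ) {E : Set X}
    (hE : μH[τ] E = 0) {ε : ℝ} (hε : 0 < ε) :
    ∃ (c : ℕ → X) (r : ℕ → ℝ), (∀ j, 0 < r j ∧ r j ≤ ε) ∧ E ⊆ ⋃ j, Metric.closedBall (c j) (r j) ∧
      ∑' j, ENNReal.ofReal (r j ^ τ) ≤ ENNReal.ofReal ε := by
  have hε2 : (0 : ℝ≥0∞) < ENNReal.ofReal (ε / 2) := ENNReal.ofReal_pos.2 (by positivity)
  rw [hausdorffMeasure_apply] at hE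
  have h1 : (⨅ (t : ℕ → Set X) (_ : E ⊆ ⋃ n, t n)
      (_ : ∀ n, Metric.ediam (t n) ≤ ENNReal.ofReal (ε / 2)),
      ∑' n, ⨆ _ : (t n).Nonempty, Metric.ediam (t n) ^ τ) < ENNReal.ofReal (ε / 2) := by
    refine lt_of_le_of_lt ?_ hε2
    rw [← hE]
    exact le_iSup₂_of_le (ENNReal.ofReal (ε / 2)) hε2 le_rfl
  simp only [iInf_lt_iff] at h1
  obtain ⟨t, htE, htd, hts⟩ := h1
  obtain ⟨δ, hδ, hδs⟩ := ENNReal.exists_pos_sum_of_countable hε2.ne' ℕ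
  have hx0 : Nonempty X := inferInstance
  obtain ⟨x0⟩ := hx0
  classical
  -- enlarge the diameters slightly to make the radii positive
  have hr : ∀ j, ∃ r : ℝ, 0 < r ∧ r ≤ ε ∧ (∀ x ∈ t j, ∀ y ∈ t j, dist x y ≤ r) ∧
      ENNReal.ofReal (r ^ τ) ≤ (⨆ _ : (t j).Nonempty, Metric.ediam (t j) ^ τ) + δ j := by
    intro j
    have hfin : Metric.ediam (t j) ≠ ⊤ := ((htd j).trans_lt ENNReal.ofReal_lt_top).ne
    set d := (Metric.ediam (t j)).toReal with hd
    have hd0 : 0 ≤ d := ENNReal.toReal_nonneg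
    have hdε : d ≤ ε / 2 := ENNReal.toReal_le_of_le_ofReal (by positivity) (htd j)
    have hcont : Tendsto (fun r : ℝ => r ^ τ) (𝓝[>] d) (𝓝 (d ^ τ)) :=
      ((Real.continuous_rpow_const hτ.le).tendsto d).mono_left nhdsWithin_le_nhds
    have hev := hcont.eventually (gt_mem_nhds (show d ^ τ < d ^ τ + δ j by
      have := hδ j
      have : (0 : ℝ) < δ j := by exact_mod_cast this
      linarith))
    have hev2 : ∀ᶠ r in 𝓝[>] d, r ≤ ε :=
      nhdsWithin_le_nhds (Iic_mem_nhds (by linarith))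
    obtain ⟨r, hr1, hr2, hr3⟩ := (hev.and (hev2.and self_mem_nhdsWithin)).exists
    refine ⟨r, hd0.trans_lt hr3, hr2, fun x hx y hy => ?_, ?_⟩
    · refine le_trans ?_ (le_of_lt hr3)
      rw [dist_edist]
      exact ENNReal.toReal_mono hfin (Metric.edist_le_ediam_of_mem hx hy)
    · have h2 : ENNReal.ofReal (r ^ τ) ≤ ENNReal.ofReal (d ^ τ) + δ j := by
        refine (ENNReal.ofReal_le_ofReal hr1.le).trans ?_
        rw [ENNReal.ofReal_add (by positivity) (by positivity), ENNReal.ofReal_coe_nnreal]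
      refine h2.trans ?_
      gcongr
      rcases (t j).eq_empty_or_nonempty with he | hne
      · have : d = 0 := by simp [hd, he]
        rw [this, Real.zero_rpow hτ.ne']
        simp
      · refine le_iSup_of_le hne ?_
        rw [← ENNReal.ofReal_rpow_of_nonneg hd0 hτ.le, hd, ENNReal.ofReal_toReal hfin]
  choose r hr0 hrε hrd hrs using hr
  -- The default centre `x0` is used only for empty `t j`, which have nothing to cover.
  refine ⟨fun j => if h : (t j).Nonempty then h.some else x0, r, fun j => ⟨hr0 j, hrε j⟩, ?_, ?_⟩
  · refine htE.trans (iUnion_mono fun j x hx => ?_)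
    have hne : (t j).Nonempty := ⟨x, hx⟩
    simp only [hne, dite_true, Metric.mem_closedBall]
    exact hrd j x hx _ hne.some_mem
  · calc ∑' j, ENNReal.ofReal (r j ^ τ)
        ≤ ∑' j, ((⨆ _ : (t j).Nonempty, Metric.ediam (t j) ^ τ) + δ j) := ENNReal.tsum_le_tsum hrs
      _ = _ + _ := ENNReal.tsum_add
      _ ≤ ENNReal.ofReal (ε / 2) + ENNReal.ofReal (ε / 2) := add_le_add hts.le hδs.le
      _ = ENNReal.ofReal ε := by
        rw [← ENNReal.ofReal_add (by positivity) (by positivity)]; congr 1; ring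

/-- Coverings by small closed balls of arbitrarily small content force Hausdorff measure zero. -/
theorem hausdorffMeasure_eq_zero_of_closedBall_cover {X : Type*} [MetricSpace X]
    [MeasurableSpace X] [BorelSpace X] {τ : ℝ} (hτ : 0 < τ) {E : Set X}
    (ι : ℕ → Type*) [∀ k, Countable (ι k)] (c : ∀ k, ι k → X) (r : ∀ k, ι k → ℝ) (ρ : ℕ → ℝ)
    (hρ : Tendsto ρ atTop (𝓝 0)) (hr0 : ∀ k i, 0 ≤ r k i) (hr : ∀ k i, r k i ≤ ρ k)
    (S : ∀ k, Set (ι k))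
    (hE : ∀ k, E ⊆ ⋃ i ∈ S k, Metric.closedBall (c k i) (r k i))
    (hs : Tendsto (fun k => ∑' i, (S k).indicator (fun i => ENNReal.ofReal (r k i ^ τ)) i)
      atTop (𝓝 0)) :
    μH[τ] E = 0 := by
  have hdiam : ∀ k i, Metric.ediam (Metric.closedBall (c k i) (r k i)) ≤
      ENNReal.ofReal (2 * r k i) := fun k i => by
    rw [← Metric.closedEBall_ofReal (hr0 k i), ENNReal.ofReal_mul (by norm_num)]
    refine Metric.ediam_closedEBall_le.trans ?_
    simp
  have h := hausdorffMeasure_le_liminf_tsum (ι := fun k => S k) τ E (l := atTop)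
    (fun k => ENNReal.ofReal (2 * ρ k)) (by
      have := (ENNReal.continuous_ofReal.tendsto _).comp (hρ.const_mul 2)
      rw [mul_zero, ENNReal.ofReal_zero] at this
      exact this)
    (fun k i => Metric.closedBall (c k i) (r k i))
    (Eventually.of_forall fun k i => (hdiam k i).trans
      (ENNReal.ofReal_le_ofReal (by linarith [hr k i])))
    (Eventually.of_forall fun k => by
      refine (hE k).trans ?_
      intro x hx
      simp only [mem_iUnion] at hx ⊢
      obtain ⟨i, hi, hx⟩ := hx
      exact ⟨⟨i, hi⟩, hx⟩)
  refine le_antisymm (h.trans ?_) zero_le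
  have h2 : Tendsto (fun k => ENNReal.ofReal (2 ^ τ) *
      ∑' i, (S k).indicator (fun i => ENNReal.ofReal (r k i ^ τ)) i) atTop (𝓝 0) := by
    have := ENNReal.Tendsto.const_mul hs (a := ENNReal.ofReal (2 ^ τ)) (Or.inr ENNReal.ofReal_ne_top)
    simpa using this
  rw [← h2.liminf_eq]
  refine liminf_le_liminf (Eventually.of_forall fun k => ?_)
  rw [← tsum_subtype, ← ENNReal.tsum_mul_left]
  refine ENNReal.tsum_le_tsum fun i => ?_
  refine (ENNReal.rpow_le_rpow (hdiam k i) hτ.le).trans ?_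
  rw [ENNReal.ofReal_rpow_of_nonneg (by linarith [hr0 k i]) hτ.le,
    Real.mul_rpow (by norm_num) (hr0 k i), ENNReal.ofReal_mul (by positivity)]

/-- If every ball of radius `r` centred in `A` has mass at least `M > 0` for a finite measure,
then `A` is covered by at most `μ(X) / M` balls of radius `2 r`. -/
theorem exists_finset_cover_of_le_measure_closedBall {X : Type*} [MetricSpace X]
    [MeasurableSpace X] [BorelSpace X] (μ : Measure X) [IsFiniteMeasure μ] {A : Set X} {r M : ℝ}
    (hM : 0 < M) (h : ∀ x ∈ A, ENNReal.ofReal M ≤ μ (Metric.closedBall x r)) :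
    ∃ T : Finset X, ↑T ⊆ A ∧ A ⊆ ⋃ a ∈ T, Metric.closedBall a (2 * r) ∧
      (T.card : ℝ) ≤ μ.real univ / M := by
  classical
  -- Balls of radius `r` about 2r-separated points are disjoint and each carries mass at least `M`.
  have hcard : ∀ T : Finset X, ↑T ⊆ A → (∀ x ∈ T, ∀ y ∈ T, x ≠ y → 2 * r < dist x y) →
      (T.card : ℝ) ≤ μ.real univ / M := by
    intro T hTA hT
    rw [le_div_iff₀ hM]
    have hdisj : (T : Set X).PairwiseDisjoint fun x => Metric.closedBall x r := by
      intro x hx y hy hxy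
      exact Metric.closedBall_disjoint_closedBall (by linarith [hT x hx y hy hxy])
    have h1 : ∑ x ∈ T, ENNReal.ofReal M ≤ μ univ :=
      calc ∑ x ∈ T, ENNReal.ofReal M ≤ ∑ x ∈ T, μ (Metric.closedBall x r) :=
            Finset.sum_le_sum fun x hx => h x (hTA hx)
        _ = μ (⋃ x ∈ T, Metric.closedBall x r) :=
            (measure_biUnion_finset hdisj fun x _ => Metric.isClosed_closedBall.measurableSet).symm
        _ ≤ μ univ := measure_mono (subset_univ _)
    have h2 := ENNReal.toReal_mono (measure_ne_top μ univ) h1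
    simpa [ENNReal.toReal_ofReal hM.le, Measure.real] using h2
  -- Cardinalities of separated sets are bounded, so a largest one exists. It yields the cover,
  -- because an uncovered point could be added to it.
  set good : ℕ → Prop := fun k => ∃ T : Finset X, ↑T ⊆ A ∧
    (∀ x ∈ T, ∀ y ∈ T, x ≠ y → 2 * r < dist x y) ∧ T.card = k with hgood
  have h0 : good 0 := ⟨∅, by simp, by simp, rfl⟩
  have hb : ∀ k, good k → k ≤ ⌊μ.real univ / M⌋₊ := by
    rintro k ⟨T, h1, h2, rfl⟩
    exact Nat.le_floor (hcard T h1 h2)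
  have hmax := Nat.findGreatest_spec (P := good) (Nat.zero_le ⌊μ.real univ / M⌋₊) h0
  obtain ⟨T, hTA, hTs, hTc⟩ := hmax
  refine ⟨T, hTA, fun x hx => ?_, hcard T hTA hTs⟩
  by_contra hcon
  simp only [mem_iUnion, Metric.mem_closedBall, not_exists, not_le] at hcon
  -- The uncovered point is new unless `r < 0`; that case is excluded since an empty ball has no
  -- mass.
  have hxT : x ∉ T ∨ r < 0 := by
    by_contra! hh
    have := hcon x hh.1
    rw [dist_self] at this
    linarith
  have hr : ¬ r < 0 := fun hr => by
    have := h x hx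
    rw [Metric.closedBall_eq_empty.2 hr, measure_empty] at this
    exact absurd this (not_le.2 (ENNReal.ofReal_pos.2 hM))
  have hxT' : x ∉ T := hxT.resolve_right hr
  have hg : good (T.card + 1) := by
    refine ⟨insert x T, ?_, ?_, Finset.card_insert_of_notMem hxT'⟩
    · simp [Set.insert_subset_iff, hx, hTA]
    · intro a ha b hb hab
      rw [Finset.mem_insert] at ha hb
      rcases ha with rfl | ha <;> rcases hb with rfl | hb
      · exact absurd rfl hab
      · exact hcon b hb
      · rw [dist_comm]; exact hcon a ha
      · exact hTs a ha b hb hab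
  have := Nat.le_findGreatest (hb _ hg) hg
  omega

/-! ### Null products and null slices -/

/-- If `A` has `s`-dimensional covering numbers and `B` is `ℋᵗ`-null, then `A × B` is
`ℋˢ⁺ᵗ`-null. -/
theorem hausdorffMeasure_image2_eq_zero {X Y Z : Type*} [MetricSpace X] [MetricSpace Y]
    [MetricSpace Z] [MeasurableSpace Y] [BorelSpace Y] [MeasurableSpace Z] [BorelSpace Z]
    (f : X → Y → Z) (hf : ∀ x x' y y', dist (f x y) (f x' y') ≤ dist x x' + dist y y')
    {s t : ℝ} (hs : 0 < s) (ht : 0 < t) {A : Set X} {B : Set Y} {K ρ : ℝ} (hK : 0 ≤ K)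
    (hρ : 0 < ρ)
    (hA : ∀ r, 0 < r → r ≤ ρ → ∃ T : Finset X, A ⊆ ⋃ a ∈ T, Metric.closedBall a (2 * r) ∧
      (T.card : ℝ) ≤ K * r ^ (-s))
    (hB : μH[t] B = 0) : μH[s + t] (image2 f A B) = 0 := by
  rcases B.eq_empty_or_nonempty with rfl | ⟨y0, hy0⟩
  · simp
  have : Nonempty Y := ⟨y0⟩
  have hε : ∀ k : ℕ, 0 < min ρ (1 / ((k : ℝ) + 1)) := fun k => lt_min hρ (by positivity)
  choose c r hr hBc hsum using fun k : ℕ =>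
    exists_closedBall_cover_of_hausdorffMeasure_eq_zero ht hB (hε k)
  -- `A` is covered at the scale r of each ball covering `B`. Product pieces have radius 2r + r =
  -- 3r, and at most K r^(-s) of them contribute K 3^(s+t) r^t in total.
  choose T hT hTc using fun k j => hA (r k j) (hr k j).1 ((hr k j).2.trans (min_le_left _ _))
  have hlim : Tendsto (fun k : ℕ => 3 * (1 / ((k : ℝ) + 1))) atTop (𝓝 0) := by
    simpa using tendsto_one_div_add_atTop_nhds_zero_nat.const_mul (3 : ℝ)
  refine hausdorffMeasure_eq_zero_of_closedBall_cover (by positivity)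
    (fun k => Σ j : ℕ, T k j) (fun k i => f i.2 (c k i.1)) (fun k i => 3 * r k i.1)
    (fun k => 3 * (1 / ((k : ℝ) + 1))) hlim
    (fun k i => by have := (hr k i.1).1; positivity)
    (fun k i => by have := (hr k i.1).2.trans (min_le_right _ _); linarith) (fun _ => univ)
    (fun k => ?_) ?_
  · rintro _ ⟨x, hx, y, hy, rfl⟩
    obtain ⟨j, hj⟩ := mem_iUnion.1 (hBc k hy)
    obtain ⟨a, ha, hxa⟩ := mem_iUnion₂.1 (hT k j hx)
    refine mem_iUnion₂.2 ⟨⟨j, ⟨a, ha⟩⟩, mem_univ _, ?_⟩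
    rw [Metric.mem_closedBall] at *
    refine (hf _ _ _ _).trans ?_
    simp only
    linarith
  · have hbound : ∀ k, ∑' i : (Σ j : ℕ, T k j),
        (univ : Set (Σ j : ℕ, T k j)).indicator
          (fun i => ENNReal.ofReal ((3 * r k i.1) ^ (s + t))) i
        ≤ ENNReal.ofReal (K * 3 ^ (s + t)) * ENNReal.ofReal (1 / ((k : ℝ) + 1)) := by
      intro k
      simp only [indicator_univ]
      rw [ENNReal.tsum_sigma']
      calc ∑' j, ∑' _ : T k j, ENNReal.ofReal ((3 * r k j) ^ (s + t))
          ≤ ∑' j, ENNReal.ofReal (K * 3 ^ (s + t)) * ENNReal.ofReal (r k j ^ t) := by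
            refine ENNReal.tsum_le_tsum fun j => ?_
            have h0 := (hr k j).1
            rw [tsum_fintype, Finset.sum_const, nsmul_eq_mul, Finset.card_univ, Fintype.card_coe,
              ← ENNReal.ofReal_natCast, ← ENNReal.ofReal_mul (by positivity),
              ← ENNReal.ofReal_mul (by positivity)]
            refine ENNReal.ofReal_le_ofReal ?_
            calc ((T k j).card : ℝ) * (3 * r k j) ^ (s + t)
                ≤ (K * r k j ^ (-s)) * (3 * r k j) ^ (s + t) := by gcongr; exact hTc k j
              _ = K * 3 ^ (s + t) * (r k j ^ (-s) * r k j ^ (s + t)) := by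
                rw [Real.mul_rpow (by norm_num) h0.le]; ring
              _ = K * 3 ^ (s + t) * r k j ^ t := by
                rw [← Real.rpow_add h0]; congr 2; ring
        _ = ENNReal.ofReal (K * 3 ^ (s + t)) * ∑' j, ENNReal.ofReal (r k j ^ t) :=
            ENNReal.tsum_mul_left
        _ ≤ _ := by
            gcongr
            exact (hsum k).trans (ENNReal.ofReal_le_ofReal (min_le_right _ _))
    have hlim2 : Tendsto (fun k : ℕ => ENNReal.ofReal (K * 3 ^ (s + t)) *
        ENNReal.ofReal (1 / ((k : ℝ) + 1))) atTop (𝓝 0) := by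
      have h1 := (ENNReal.continuous_ofReal.tendsto _).comp
        (tendsto_one_div_add_atTop_nhds_zero_nat (𝕜 := ℝ))
      have := ENNReal.Tendsto.const_mul h1 (a := ENNReal.ofReal (K * 3 ^ (s + t)))
        (Or.inr ENNReal.ofReal_ne_top)
      simpa using this
    exact tendsto_of_tendsto_of_tendsto_of_le_of_le tendsto_const_nhds hlim2
      (fun _ => zero_le) hbound

/-- The slices of an `ℋ^τ`-null set by the level sets of a measurable family of contractions to
`ℝᵐ` are almost all `ℋ^{τ - m}`-null. -/
theorem ae_hausdorffMeasure_slice_eq_zero {Λ Z : Type*} [MeasurableSpace Λ] (ω : Measure Λ)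
    [IsFiniteMeasure ω] [MetricSpace Z] [MeasurableSpace Z] [BorelSpace Z] {m : ℕ}
    (P : Λ → Z → EuclideanSpace ℝ (Fin m)) (hP : ∀ l, LipschitzWith 1 (P l))
    (hPm : ∀ z, Measurable fun l => P l z) {τ : ℝ} (hτ : (m : ℝ) < τ) {G : Set Z}
    (hG : μH[τ] G = 0) :
    ∀ᵐ q ∂(ω.prod (volume : Measure (EuclideanSpace ℝ (Fin m)))),
      μH[τ - m] (P q.1 ⁻¹' {q.2} ∩ G) = 0 := by
  rcases G.eq_empty_or_nonempty with rfl | ⟨z0, hz0⟩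
  · simp
  have : Nonempty Z := ⟨z0⟩
  have hτ0 : 0 < τ := lt_of_le_of_lt (Nat.cast_nonneg m) hτ
  have hε : ∀ k : ℕ, (0 : ℝ) < (1 / 2) ^ k := fun k => by positivity
  choose c r hr hGc hsum using fun k : ℕ =>
    exists_closedBall_cover_of_hausdorffMeasure_eq_zero hτ0 hG (hε k)
  -- As `P l` is 1-Lipschitz, the fibre of `P l` over u can meet the j-th ball only if (l, u) lies
  -- in `S k j`. The measure of this set is a multiple of r^m, which restores the exponent τ from τ
  -- - m. No measurability of `G` is needed.
  set S : ℕ → ℕ → Set (Λ × EuclideanSpace ℝ (Fin m)) :=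
    fun k j => {q | dist q.2 (P q.1 (c k j)) ≤ r k j} with hS
  have hSm : ∀ k j, MeasurableSet (S k j) := fun k j =>
    measurableSet_le (measurable_snd.dist ((hPm (c k j)).comp measurable_fst)) measurable_const
  set V := volume (Metric.closedBall (0 : EuclideanSpace ℝ (Fin m)) 1) with hV
  have hVtop : V ≠ ⊤ := measure_closedBall_lt_top.ne
  have hSv : ∀ k j, (ω.prod volume) (S k j) = ENNReal.ofReal (r k j ^ m) * (V * ω univ) := by
    intro k j
    rw [Measure.prod_apply (hSm k j)]
    have : ∀ l, Prod.mk l ⁻¹' S k j = Metric.closedBall (P l (c k j)) (r k j) := fun l => rfl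
    simp only [this]
    simp only [Measure.addHaar_closedBall' _ _ (hr k j).1.le, finrank_euclideanSpace,
      Fintype.card_fin, lintegral_const, mul_assoc]
    rfl
  set f : ℕ → Λ × EuclideanSpace ℝ (Fin m) → ℝ≥0∞ := fun k q =>
    ∑' j, (S k j).indicator (fun _ => ENNReal.ofReal (r k j ^ (τ - m))) q with hf
  have hfm : ∀ k, Measurable (f k) := fun k =>
    Measurable.tsum fun j => measurable_const.indicator (hSm k j)
  have hint : ∀ k, ∫⁻ q, f k q ∂(ω.prod volume) ≤ ENNReal.ofReal ((1 / 2) ^ k) * (V * ω univ) := by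
    intro k
    rw [lintegral_tsum fun j => (measurable_const.indicator (hSm k j)).aemeasurable]
    simp only [lintegral_indicator_const (hSm k _), hSv]
    calc ∑' j, ENNReal.ofReal (r k j ^ (τ - m)) * (ENNReal.ofReal (r k j ^ m) * (V * ω univ))
        = ∑' j, ENNReal.ofReal (r k j ^ τ) * (V * ω univ) := by
          refine tsum_congr fun j => ?_
          have h0 := (hr k j).1
          rw [← mul_assoc, ← ENNReal.ofReal_mul (by positivity), ← Real.rpow_natCast,
            ← Real.rpow_add h0]
          simp
      _ = (∑' j, ENNReal.ofReal (r k j ^ τ)) * (V * ω univ) := ENNReal.tsum_mul_right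
      _ ≤ _ := by gcongr; exact hsum k
  -- The contents were chosen at most 2^(-k) so that the sum over k is integrable; hence `f k q`
  -- tends to 0 for almost all `q`.
  have htot : ∫⁻ q, ∑' k, f k q ∂(ω.prod volume) ≠ ⊤ := by
    rw [lintegral_tsum fun k => (hfm k).aemeasurable]
    refine ne_top_of_le_ne_top ?_ (ENNReal.tsum_le_tsum hint)
    rw [ENNReal.tsum_mul_right]
    refine ENNReal.mul_ne_top ?_ (ENNReal.mul_ne_top hVtop (measure_ne_top _ _))
    exact (summable_geometric_of_lt_one (by norm_num) (by norm_num :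
      (1 / 2 : ℝ) < 1)).tsum_ofReal_ne_top
  filter_upwards [ae_lt_top (Measurable.tsum hfm) htot] with q hq
  refine hausdorffMeasure_eq_zero_of_closedBall_cover (sub_pos.2 hτ) (fun _ => ℕ) c r
    (fun k => (1 / 2 : ℝ) ^ k) (tendsto_pow_atTop_nhds_zero_of_lt_one (by norm_num) (by norm_num))
    (fun k i => (hr k i).1.le) (fun k i => (hr k i).2) (fun k => {j | q ∈ S k j}) (fun k => ?_) ?_
  · rintro z ⟨hz, hzG⟩
    obtain ⟨j, hj⟩ := mem_iUnion.1 (hGc k hzG)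
    refine mem_iUnion₂.2 ⟨j, ?_, hj⟩
    have h1 := (hP q.1).dist_le_mul z (c k j)
    rw [NNReal.coe_one, one_mul] at h1
    have h2 : P q.1 z = q.2 := hz
    rw [h2] at h1
    exact h1.trans hj
  · exact ENNReal.tendsto_atTop_zero_of_tsum_ne_top hq.ne

/-! ### Dimension bounds from mass distributions -/

/-- A mass distribution principle: if a measure satisfies `κ (B(z, r₀ 2⁻ᵏ)) ≤ N 2^{-kτ}` at all
points of `E` and scales `k`, then a set meeting `E` in positive measure has dimension at
least `τ`. -/
theorem le_dimH_of_measure_closedBall_le {Z : Type*} [MetricSpace Z] [MeasurableSpace Z]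
    [BorelSpace Z] (κ : Measure Z) {E F : Set Z} (hE : MeasurableSet E) {τ : NNReal} (hτ : 0 < τ)
    {r₀ N : ℝ} (hr₀ : 0 < r₀) (hN : 0 < N)
    (h : ∀ z ∈ E, ∀ k : ℕ, κ (Metric.closedBall z (r₀ * (1 / 2) ^ k)) ≤
      ENNReal.ofReal (N * ((1 / 2) ^ k) ^ (τ : ℝ)))
    (hEF : κ (E ∩ F) ≠ 0) : (τ : ℝ≥0∞) ≤ dimH F := by
  have hτ' : (0 : ℝ) < τ := by exact_mod_cast hτ
  -- A set of diameter d > 0 is compared with a dyadic radius satisfying d ≤ r₀ 2^(-k) < 2d, which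
  -- is the source of the factor (2 / r₀)^τ.
  set C : ℝ := N * (2 / r₀) ^ (τ : ℝ) with hC
  have hC0 : 0 < C := by positivity
  have key : (ENNReal.ofReal C)⁻¹ • κ.restrict E ≤ μH[(τ : ℝ)] := by
    refine Measure.le_hausdorffMeasure _ _ (ENNReal.ofReal r₀) (ENNReal.ofReal_pos.2 hr₀) ?_
    intro U hU
    rw [Measure.smul_apply, smul_eq_mul, Measure.restrict_apply' hE]
    rw [ENNReal.inv_mul_le_iff (ENNReal.ofReal_pos.2 hC0).ne' ENNReal.ofReal_ne_top]
    rcases (U ∩ E).eq_empty_or_nonempty with he | ⟨z, hzU, hzE⟩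
    · simp [he]
    have hfin : Metric.ediam U ≠ ⊤ := (hU.trans_lt ENNReal.ofReal_lt_top).ne
    set d := (Metric.ediam U).toReal with hd
    have hd0 : 0 ≤ d := ENNReal.toReal_nonneg
    have hdr : d ≤ r₀ := ENNReal.toReal_le_of_le_ofReal hr₀.le hU
    have hsub : ∀ k : ℕ, d ≤ r₀ * (1 / 2) ^ k →
        κ (U ∩ E) ≤ ENNReal.ofReal (N * ((1 / 2) ^ k) ^ (τ : ℝ)) := by
      intro k hk
      refine (measure_mono fun y hy => ?_).trans (h z hzE k)
      rw [Metric.mem_closedBall, dist_edist]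
      exact (ENNReal.toReal_mono hfin (Metric.edist_le_ediam_of_mem hy.1 hzU)).trans hk
    rcases hd0.eq_or_lt with hd0 | hd0
    -- For diameter zero every scale k is admissible and the bounds tend to 0.
    · have hlim : Tendsto (fun k : ℕ => ENNReal.ofReal (N * ((1 / 2) ^ k) ^ (τ : ℝ))) atTop
          (𝓝 0) := by
        have h1 : Tendsto (fun k : ℕ => (1 / 2 : ℝ) ^ k) atTop (𝓝 0) :=
          tendsto_pow_atTop_nhds_zero_of_lt_one (by norm_num) (by norm_num)
        have h2 := ((Real.continuous_rpow_const hτ'.le).tendsto 0).comp h1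
        have h3 := (ENNReal.continuous_ofReal.tendsto _).comp (h2.const_mul N)
        rw [Real.zero_rpow hτ'.ne', mul_zero, ENNReal.ofReal_zero] at h3
        exact h3
      refine (ge_of_tendsto' hlim fun k => hsub k ?_).trans zero_le
      rw [← hd0]; positivity
    · obtain ⟨k, hk1, hk2⟩ := exists_nat_pow_near_of_lt_one (x := d / r₀) (by positivity)
        ((div_le_one hr₀).2 hdr) (by norm_num : (0 : ℝ) < 1 / 2) (by norm_num)
      refine (hsub k ?_).trans ?_
      · rwa [div_le_iff₀ hr₀, mul_comm] at hk2
      · rw [← ENNReal.ofReal_toReal hfin, ← hd, ENNReal.ofReal_rpow_of_nonneg hd0.le hτ'.le,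
          ← ENNReal.ofReal_mul hC0.le]
        refine ENNReal.ofReal_le_ofReal ?_
        rw [hC, mul_assoc, ← Real.mul_rpow (by positivity) hd0.le]
        gcongr
        rw [pow_succ] at hk1
        have : (1 / 2 : ℝ) ^ k < 2 * (d / r₀) := by linarith
        calc (1 / 2 : ℝ) ^ k ≤ 2 * (d / r₀) := this.le
          _ = 2 / r₀ * d := by ring
  refine le_dimH_of_hausdorffMeasure_ne_zero fun h0 => ?_
  have h1 := (key F).trans h0.le
  rw [Measure.smul_apply, smul_eq_mul, Measure.restrict_apply' hE, inter_comm] at h1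
  have := mul_eq_zero.1 (le_antisymm h1 zero_le)
  rcases this with h2 | h2
  · exact ENNReal.ofReal_ne_top (ENNReal.inv_eq_zero.1 h2)
  · exact hEF h2

/-- A finite discrete energy at exponent `τ` forces dimension at least `τ`. -/
theorem le_dimH_of_tsum_measure_sq_ne_top {Z : Type*} [MetricSpace Z] [MeasurableSpace Z]
    [BorelSpace Z] (κ : Measure Z) [IsFiniteMeasure κ] {D F : Set Z}
    (hD : MeasurableSet D) (hDF : κ (D ∩ F) ≠ 0) {τ : NNReal} (hτ : 0 < τ)
    {r₀ : ℝ} (hr₀ : 0 < r₀) (ι : ℕ → Type*) [∀ k, Countable (ι k)] (Q : ∀ k, ι k → Set Z)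
    (hQ : ∀ k i, MeasurableSet (Q k i))
    (hcov : ∀ k, ∀ z ∈ D, ∃ i, Metric.closedBall z (r₀ * (1 / 2) ^ k) ⊆ Q k i)
    (hsum : ∑' k, ENNReal.ofReal ((2 ^ k) ^ (τ : ℝ)) * ∑' i, κ (Q k i) ^ 2 ≠ ⊤) :
    (τ : ℝ≥0∞) ≤ dimH (D ∩ F) := by
  set E₀ := ∑' k, ENNReal.ofReal ((2 ^ k) ^ (τ : ℝ)) * ∑' i, κ (Q k i) ^ 2 with hE₀
  -- By Chebyshev, the cells violating the growth bound with constant `N` have total mass at most E₀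
  -- / N. `N` is large enough for them to miss part of the mass of `D ∩ F`.
  obtain ⟨N, hN1, hN⟩ : ∃ N : ℝ, 0 < N ∧ E₀ / ENNReal.ofReal N < κ (D ∩ F) := by
    have h1 : Tendsto (fun n : ℕ => E₀ / (n : ℝ≥0∞)) atTop (𝓝 0) := by
      have := ENNReal.Tendsto.const_mul ENNReal.tendsto_inv_nat_nhds_zero (a := E₀) (Or.inr hsum)
      simpa [div_eq_mul_inv] using this
    obtain ⟨n, hn, hn0⟩ := ((h1.eventually (gt_mem_nhds (pos_iff_ne_zero.2 hDF))).and
      (eventually_gt_atTop 0)).exists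
    refine ⟨n, by exact_mod_cast hn0, by simpa using hn⟩
  set b : ℕ → ℝ≥0∞ := fun k => ENNReal.ofReal (N * ((1 / 2) ^ k) ^ (τ : ℝ)) with hb
  have hb0 : ∀ k, b k ≠ 0 := fun k => (ENNReal.ofReal_pos.2 (by positivity)).ne'
  have hbinv : ∀ k, (b k)⁻¹ = ENNReal.ofReal ((2 ^ k) ^ (τ : ℝ)) / ENNReal.ofReal N := by
    intro k
    rw [hb, ← ENNReal.ofReal_inv_of_pos (by positivity), ← ENNReal.ofReal_div_of_pos hN1]
    congr 1
    rw [mul_inv, ← Real.inv_rpow (by positivity), one_div, inv_pow, inv_inv, div_eq_inv_mul]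
  -- `V k` is the union of the heavy cells, for which κ(Q) ≤ κ(Q)² / b k. A point of `D` outside it
  -- has its k-th ball inside a light cell.
  set V : ℕ → Set Z := fun k => ⋃ i ∈ {i | b k < κ (Q k i)}, Q k i with hV
  have hVm : ∀ k, MeasurableSet (V k) := fun k =>
    MeasurableSet.biUnion (Set.to_countable _) fun i _ => hQ k i
  have hVle : ∀ k, κ (V k) ≤ (b k)⁻¹ * ∑' i, κ (Q k i) ^ 2 := by
    intro k
    refine (measure_biUnion_le κ (Set.to_countable _) _).trans ?_
    rw [← ENNReal.tsum_mul_left]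
    refine (ENNReal.tsum_le_tsum fun i => ?_).trans
      (ENNReal.tsum_comp_le_tsum_of_injective Subtype.val_injective _)
    have hi : b k < κ (Q k i) := i.2
    calc κ (Q k i) = (b k)⁻¹ * (b k * κ (Q k i)) := by
          rw [← mul_assoc, ENNReal.inv_mul_cancel (hb0 k) ENNReal.ofReal_ne_top, one_mul]
      _ ≤ (b k)⁻¹ * κ (Q k i) ^ 2 := by
          rw [sq]; gcongr
  have hVU : κ (⋃ k, V k) < κ (D ∩ F) := by
    refine lt_of_le_of_lt ?_ hN
    refine (measure_iUnion_le V).trans ?_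
    rw [hE₀, div_eq_mul_inv, ← ENNReal.tsum_mul_right]
    refine ENNReal.tsum_le_tsum fun k => (hVle k).trans (le_of_eq ?_)
    rw [hbinv, div_eq_mul_inv]; ring
  refine le_dimH_of_measure_closedBall_le κ (E := D \ ⋃ k, V k)
    (hD.diff (MeasurableSet.iUnion hVm)) hτ hr₀ hN1 ?_ ?_
  · rintro z ⟨hzD, hzV⟩ k
    obtain ⟨i, hi⟩ := hcov k z hzD
    refine (measure_mono hi).trans ?_
    by_contra hcon
    refine hzV (mem_iUnion.2 ⟨k, mem_iUnion₂.2 ⟨i, not_le.1 hcon, hi ?_⟩⟩)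
    exact Metric.mem_closedBall_self (by positivity)
  · intro h0
    have h1 : D ∩ F ⊆ ((D \ ⋃ k, V k) ∩ (D ∩ F)) ∪ ⋃ k, V k := by
      intro z hz
      by_cases hzV : z ∈ ⋃ k, V k
      · exact Or.inr hzV
      · exact Or.inl ⟨⟨hz.1, hzV⟩, hz⟩
    have h2 := (measure_mono h1).trans (measure_union_le (μ := κ) _ _)
    rw [h0, zero_add] at h2
    exact absurd h2 (not_le.2 hVU)

/-! ### Densities and regular pieces -/

/-- For a finite measure, the set of points of infinite upper `s`-density is `ℋˢ`-null. -/
theorem hausdorffMeasure_infinite_upperDensity_eq_zero {X : Type*} [MetricSpace X]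
    [SecondCountableTopology X] [MeasurableSpace X] [BorelSpace X] (μ : Measure X)
    [IsFiniteMeasure μ] {s : ℝ} (hs : 0 < s) :
    μH[s] {x | ∀ N : ℕ, ∃ r : ℝ, 0 < r ∧ r ≤ 1 / ((N : ℝ) + 1) ∧
      ENNReal.ofReal ((N + 1) * r ^ s) < μ (Metric.closedBall x r)} = 0 := by
  set E := {x | ∀ N : ℕ, ∃ r : ℝ, 0 < r ∧ r ≤ 1 / ((N : ℝ) + 1) ∧
      ENNReal.ofReal ((N + 1) * r ^ s) < μ (Metric.closedBall x r)} with hE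
  have hchoice : ∀ (k : ℕ) (x : X), ∃ r : ℝ, x ∈ E → 0 < r ∧ r ≤ 1 / ((k : ℝ) + 1) ∧
      ENNReal.ofReal ((k + 1) * r ^ s) < μ (Metric.closedBall x r) := by
    intro k x
    by_cases hx : x ∈ E
    · obtain ⟨r, hr⟩ := hx k
      exact ⟨r, fun _ => hr⟩
    · exact ⟨0, fun h => absurd h hx⟩
  choose r hr using hchoice
  -- The selected balls are disjoint, have mass above (k + 1) r^s, and cover `E` after fivefold
  -- enlargement. The resulting content is at most 5^s μ(X) / (k + 1).
  choose u huE hud huc using fun k : ℕ =>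
    Vitali.exists_disjoint_subfamily_covering_enlargement_closedBall E (fun x => x) (r k)
      (1 / ((k : ℝ) + 1)) (fun a ha => (hr k a ha).2.1) 5 (by norm_num)
  have hucount : ∀ k, Countable (u k) := fun k =>
    ((hud k).countable_of_nonempty_interior fun x hx =>
      ⟨x, Metric.ball_subset_interior_closedBall
        (Metric.mem_ball_self (hr k x (huE k hx)).1)⟩).to_subtype
  have hlim : Tendsto (fun k : ℕ => 5 * (1 / ((k : ℝ) + 1))) atTop (𝓝 0) := by
    simpa using tendsto_one_div_add_atTop_nhds_zero_nat.const_mul (5 : ℝ)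
  refine hausdorffMeasure_eq_zero_of_closedBall_cover hs (fun k => u k) (fun k i => (i : X))
    (fun k i => 5 * r k i) (fun k => 5 * (1 / ((k : ℝ) + 1))) hlim
    (fun k i => by have := (hr k i (huE k i.2)).1; positivity)
    (fun k i => by have := (hr k i (huE k i.2)).2.1; linarith) (fun _ => univ) (fun k => ?_) ?_
  · intro x hx
    obtain ⟨b, hb, hsub⟩ := huc k x hx
    exact mem_iUnion₂.2 ⟨⟨b, hb⟩, mem_univ _,
      hsub (Metric.mem_closedBall_self (hr k x hx).1.le)⟩
  · have hbound : ∀ k, ∑' i : u k, (univ : Set (u k)).indicator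
        (fun i => ENNReal.ofReal ((5 * r k i) ^ s)) i
        ≤ ENNReal.ofReal (5 ^ s * (1 / ((k : ℝ) + 1))) * μ univ := by
      intro k
      simp only [indicator_univ]
      calc ∑' i : u k, ENNReal.ofReal ((5 * r k i) ^ s)
          ≤ ∑' i : u k, ENNReal.ofReal (5 ^ s * (1 / ((k : ℝ) + 1))) *
              μ (Metric.closedBall (i : X) (r k i)) := by
            refine ENNReal.tsum_le_tsum fun i => ?_
            obtain ⟨h0, -, h2⟩ := hr k i (huE k i.2)
            refine le_trans (le_of_eq ?_) (mul_le_mul_right h2.le _)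
            rw [← ENNReal.ofReal_mul (by positivity), Real.mul_rpow (by norm_num) h0.le]
            congr 1
            field_simp
        _ = ENNReal.ofReal (5 ^ s * (1 / ((k : ℝ) + 1))) *
              ∑' i : u k, μ (Metric.closedBall (i : X) (r k i)) := ENNReal.tsum_mul_left
        _ ≤ _ := by
            gcongr
            refine tsum_meas_le_meas_iUnion_of_disjoint μ
              (fun i => Metric.isClosed_closedBall.measurableSet) ?_ |>.trans
              (measure_mono (subset_univ _))
            exact fun i j hij => hud k i.2 j.2 fun h => hij (Subtype.ext h)
    have hlim2 : Tendsto (fun k : ℕ => ENNReal.ofReal (5 ^ s * (1 / ((k : ℝ) + 1))) * μ univ)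
        atTop (𝓝 0) := by
      have h1 := (ENNReal.continuous_ofReal.tendsto _).comp
        ((tendsto_one_div_add_atTop_nhds_zero_nat (𝕜 := ℝ)).const_mul (5 ^ s))
      have := ENNReal.Tendsto.mul_const h1 (b := μ univ) (Or.inr (measure_ne_top _ _))
      simpa using this
    exact tendsto_of_tendsto_of_tendsto_of_le_of_le tendsto_const_nhds hlim2
      (fun _ => zero_le) hbound

theorem measurable_measure_closedBall {X : Type*} [MetricSpace X]
    [SecondCountableTopology X] [MeasurableSpace X] [BorelSpace X] (μ : Measure X)
    [SFinite μ] (r : ℝ) : Measurable fun x => μ (Metric.closedBall x r) := by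
  have h : MeasurableSet {p : X × X | dist p.2 p.1 ≤ r} :=
    measurableSet_le (measurable_snd.dist measurable_fst) measurable_const
  exact measurable_measure_prodMk_left h

/-- `E` is a bounded measurable set on which the measure `μ` has `s`-dimensional lower bounds, and
the restriction of `μ` to which satisfies an `s`-dimensional growth condition. -/
structure IsRegularPiece {X : Type*} [MetricSpace X] [MeasurableSpace X] (μ : Measure X) (s : ℝ)
    (E : Set X) : Prop where
  measurableSet : MeasurableSet E
  isBounded : Bornology.IsBounded E
  lower : ∃ c ρ : ℝ, 0 < c ∧ 0 < ρ ∧ ∀ x ∈ E, ∀ r : ℝ, 0 < r → r ≤ ρ →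
    ENNReal.ofReal (c * r ^ s) ≤ μ (Metric.closedBall x r)
  upper : ∃ K : ℝ, 0 < K ∧ ∀ x, ∀ r : ℝ, 0 < r →
    μ.restrict E (Metric.closedBall x r) ≤ ENNReal.ofReal (K * r ^ s)

/-- A finite measure with positive lower and finite upper `s`-densities almost everywhere is
carried by countably many bounded measurable sets on which the densities are uniformly
controlled. -/
theorem exists_regular_decomposition {X : Type*} [MetricSpace X]
    [SecondCountableTopology X] [MeasurableSpace X] [BorelSpace X] (μ : Measure X)
    [IsFiniteMeasure μ] {s : ℝ} (hs : 0 < s) (x₀ : X) {A : Set X} (hA : MeasurableSet A)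
    (hAμ : ∀ᵐ x ∂μ, x ∈ A)
    (hup : ∀ᵐ x ∂μ, ∃ N : ℕ, ∀ r : ℝ, 0 < r → r ≤ 1 / ((N : ℝ) + 1) →
      μ (Metric.closedBall x r) ≤ ENNReal.ofReal ((N + 1) * r ^ s))
    (hlow : ∀ᵐ x ∂μ, ∃ N : ℕ, ∀ r : ℝ, 0 < r → r ≤ 1 / ((N : ℝ) + 1) →
      ENNReal.ofReal (1 / ((N : ℝ) + 1) * r ^ s) ≤ μ (Metric.closedBall x r)) :
    ∃ E : ℕ → Set X, (∀ N, IsRegularPiece μ s (E N)) ∧ (∀ N, E N ⊆ A) ∧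
      ∀ᵐ x ∂μ, ∃ N, x ∈ E N := by
  -- Testing rational radii only makes `U N` and `W N` measurable; the constants below absorb the
  -- passage to real radii.
  set U : ℕ → Set X := fun N => {x | ∀ q : ℚ, 0 < (q : ℝ) → (q : ℝ) ≤ 1 / ((N : ℝ) + 1) →
      μ (Metric.closedBall x q) ≤ ENNReal.ofReal ((N + 1) * (q : ℝ) ^ s)} with hU
  set W : ℕ → Set X := fun N => {x | ∀ q : ℚ, 0 < (q : ℝ) → (q : ℝ) ≤ 1 / ((N : ℝ) + 1) →
      ENNReal.ofReal (1 / ((N : ℝ) + 1) * (q : ℝ) ^ s) ≤ μ (Metric.closedBall x q)} with hW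
  have hUm : ∀ N, MeasurableSet (U N) := fun N => by
    simp only [hU, ofPred_forall]
    refine MeasurableSet.iInter fun q => MeasurableSet.iInter fun _ => MeasurableSet.iInter fun _ =>
      measurableSet_le (measurable_measure_closedBall μ _) measurable_const
  have hWm : ∀ N, MeasurableSet (W N) := fun N => by
    simp only [hW, ofPred_forall]
    refine MeasurableSet.iInter fun q => MeasurableSet.iInter fun _ => MeasurableSet.iInter fun _ =>
      measurableSet_le measurable_const (measurable_measure_closedBall μ _)
  refine ⟨fun N => A ∩ Metric.closedBall x₀ N ∩ U N ∩ W N, fun N =>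
    ⟨(((hA.inter Metric.isClosed_closedBall.measurableSet).inter (hUm N)).inter (hWm N)),
    Metric.isBounded_closedBall.subset fun x hx => hx.1.1.2, ?_, ?_⟩,
    fun N x hx => hx.1.1.1, ?_⟩
  rotate_left 2
  · filter_upwards [hAμ, hup, hlow] with x hxA hxu hxl
    obtain ⟨N1, h1⟩ := hxu
    obtain ⟨N2, h2⟩ := hxl
    obtain ⟨N3, h3⟩ := exists_nat_ge (dist x x₀)
    have hmono : ∀ M N : ℕ, M ≤ N → 1 / ((N : ℝ) + 1) ≤ 1 / ((M : ℝ) + 1) := fun M N h =>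
      one_div_le_one_div_of_le (by positivity) (by exact_mod_cast Nat.succ_le_succ h)
    set N := max N1 (max N2 N3) with hN
    have hN1 : N1 ≤ N := le_max_left _ _
    have hN2 : N2 ≤ N := (le_max_left _ _).trans (le_max_right _ _)
    have hN3 : N3 ≤ N := (le_max_right _ _).trans (le_max_right _ _)
    have hc1 : (N1 : ℝ) ≤ N := by exact_mod_cast hN1
    have hc3 : (N3 : ℝ) ≤ N := by exact_mod_cast hN3
    refine ⟨N, ⟨⟨hxA, Metric.mem_closedBall.2 (h3.trans hc3)⟩, fun q hq hqN => ?_⟩,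
      fun q hq hqN => ?_⟩
    · refine (h1 q hq (hqN.trans (hmono _ _ hN1))).trans (ENNReal.ofReal_le_ofReal ?_)
      gcongr
    · refine le_trans (ENNReal.ofReal_le_ofReal ?_) (h2 q hq (hqN.trans (hmono _ _ hN2)))
      have := hmono _ _ hN2
      gcongr
  -- A rational radius in (r/2, r) costs the factor 2^(-s).
  · refine ⟨1 / ((N : ℝ) + 1) * (1 / 2) ^ s, 1 / ((N : ℝ) + 1), by positivity, by positivity, ?_⟩
    intro x hx r hr0 hr
    obtain ⟨q, hq1, hq2⟩ := exists_rat_btwn (show r / 2 < r by linarith)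
    have hq0 : (0 : ℝ) < q := by linarith
    refine le_trans (ENNReal.ofReal_le_ofReal ?_) ((hx.2 q hq0 (by linarith)).trans
      (measure_mono (Metric.closedBall_subset_closedBall hq2.le)))
    rw [mul_assoc, ← Real.mul_rpow (by norm_num) hr0.le]
    gcongr
    linarith
  · have hN0 : (0 : ℝ) < 4 * (N + 1) := by positivity
    -- For small r, a ball meeting the piece at z lies in B(z, 2r), and a rational radius in (2r,
    -- 4r) gives the term with 4^s. For r ≥ 1 / (4(N + 1)) the second term dominates the total mass.
    refine ⟨(N + 1) * 4 ^ s + μ.real univ * (4 * (N + 1)) ^ s, by positivity, fun x r hr => ?_⟩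
    rw [Measure.restrict_apply Metric.isClosed_closedBall.measurableSet]
    rcases (Metric.closedBall x r ∩
      (A ∩ Metric.closedBall x₀ N ∩ U N ∩ W N)).eq_empty_or_nonempty with he | ⟨z, hzx, hz⟩
    · rw [he]; simp
    have hsub : Metric.closedBall x r ⊆ Metric.closedBall z (2 * r) := by
      refine Metric.closedBall_subset_closedBall' ?_
      rw [Metric.mem_closedBall, dist_comm] at hzx
      linarith
    refine (measure_mono inter_subset_left).trans ?_
    by_cases hrN : 4 * r < 1 / ((N : ℝ) + 1)
    · obtain ⟨q, hq1, hq2⟩ := exists_rat_btwn (show 2 * r < 4 * r by linarith)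
      have hq0 : (0 : ℝ) < q := by linarith
      refine (measure_mono (hsub.trans (Metric.closedBall_subset_closedBall hq1.le))).trans
        ((hz.1.2 q hq0 (by linarith)).trans (ENNReal.ofReal_le_ofReal ?_))
      calc ((N : ℝ) + 1) * (q : ℝ) ^ s ≤ (N + 1) * (4 * r) ^ s := by gcongr
        _ = (N + 1) * 4 ^ s * r ^ s := by rw [Real.mul_rpow (by norm_num) hr.le]; ring
        _ ≤ _ := by
          gcongr
          have : 0 ≤ μ.real univ * (4 * ((N : ℝ) + 1)) ^ s := by positivity
          linarith
    · rw [not_lt, div_le_iff₀ (by positivity)] at hrN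
      refine (measure_mono (subset_univ _)).trans ?_
      rw [← ENNReal.ofReal_toReal (measure_ne_top μ univ)]
      refine ENNReal.ofReal_le_ofReal ?_
      change μ.real univ ≤ _
      have h1 : 1 ≤ (4 * ((N : ℝ) + 1)) ^ s * r ^ s := by
        rw [← Real.mul_rpow hN0.le hr.le]
        exact Real.one_le_rpow (by linarith) hs.le
      have h2 : 0 ≤ ((N : ℝ) + 1) * 4 ^ s * r ^ s := by positivity
      nlinarith [mul_le_mul_of_nonneg_left h1 (measureReal_nonneg (μ := μ) (s := univ))]

/-- Positive lower density at a point, in quantitative form. -/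
theorem exists_le_hausdorffMeasure_of_lowerDensity_pos {n : ℕ} {s : ℝ} (hs : 0 < s)
    {A : Set (EuclideanSpace ℝ (Fin n))} {x : EuclideanSpace ℝ (Fin n)}
    (hx : 0 < lowerDensity s A x) :
    ∃ N : ℕ, ∀ r : ℝ, 0 < r → r ≤ 1 / ((N : ℝ) + 1) →
      ENNReal.ofReal (1 / ((N : ℝ) + 1) * r ^ s) ≤
        μH[s].restrict A (Metric.closedBall x r) := by
  obtain ⟨c, hc0, hc⟩ := exists_between hx
  have hev := eventually_lt_of_lt_liminf hc
  have hctop : c ≠ ⊤ := (hc.trans_le le_top).ne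
  obtain ⟨δ, hδ, hsub⟩ := mem_nhdsGT_iff_exists_Ioo_subset.1 hev
  have hδ : 0 < δ := hδ
  have hc1 : 0 < c.toReal := ENNReal.toReal_pos hc0.ne' hctop
  obtain ⟨N, hN⟩ := exists_nat_one_div_lt (lt_min hδ hc1)
  refine ⟨N, fun r hr0 hr => ?_⟩
  have h1 : c < μH[s] (A ∩ Metric.closedBall x r) / ENNReal.ofReal ((2 * r) ^ s) :=
    hsub ⟨hr0, lt_of_le_of_lt hr (hN.trans_le (min_le_left _ _))⟩
  rw [Measure.restrict_apply Metric.isClosed_closedBall.measurableSet, inter_comm]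
  have h2r : (0 : ℝ) < (2 * r) ^ s := by positivity
  rw [ENNReal.lt_div_iff_mul_lt (Or.inl (ENNReal.ofReal_pos.2 h2r).ne')
    (Or.inl ENNReal.ofReal_ne_top)] at h1
  refine le_trans ?_ h1.le
  rw [← ENNReal.ofReal_toReal hctop, ← ENNReal.ofReal_mul hc1.le]
  refine ENNReal.ofReal_le_ofReal ?_
  have := hN.trans_le (min_le_right _ _)
  gcongr
  linarith

/-! ### Rescaling the hypotheses to small balls -/

/-- The map `u ↦ r u + w`. -/
noncomputable def dilation {F : Type*} [NormedAddCommGroup F] [NormedSpace ℝ F] (r : ℝ) (hr : r ≠ 0) (w : F) :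
    F ≃ₜ F :=
  (Homeomorph.smulOfNeZero r hr).trans (Homeomorph.addRight w)

section dilation

variable {F : Type*} [NormedAddCommGroup F] [NormedSpace ℝ F]

@[simp]
theorem dilation_apply {r : ℝ} (hr : r ≠ 0) (w u : F) : dilation r hr w u = r • u + w := rfl

theorem dilation_symm_preimage_closedBall {r : ℝ} (hr : 0 < r) (w x : F) (ρ : ℝ) :
    (dilation r hr.ne' w).symm ⁻¹' Metric.closedBall x ρ =
      Metric.closedBall (r • x + w) (r * ρ) := by
  ext z
  obtain ⟨y, rfl⟩ := (dilation r hr.ne' w).surjective z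
  rw [mem_preimage, Homeomorph.symm_apply_apply]
  simp only [Metric.mem_closedBall, dilation_apply, dist_add_right, dist_smul₀, Real.norm_eq_abs, abs_of_pos hr]
  exact (mul_le_mul_iff_right₀ hr).symm

variable [MeasurableSpace F] [BorelSpace F] [FiniteDimensional ℝ F]

theorem map_dilation_addHaar (μ : Measure F) [μ.IsAddHaarMeasure] {r : ℝ} (hr : 0 < r) (w : F) :
    μ.map (dilation r hr.ne' w) = ENNReal.ofReal ((r ^ Module.finrank ℝ F)⁻¹) • μ := by
  have h1 : (dilation r hr.ne' w : F → F) = (fun x => x + w) ∘ fun x => r • x := rfl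
  rw [h1, ← Measure.map_map (measurable_add_const w) (measurable_const_smul r),
    Measure.map_addHaar_smul μ hr.ne', Measure.map_smul, map_add_right_eq_self,
    abs_of_pos (by positivity)]

theorem lintegral_comp_dilation (μ : Measure F) [μ.IsAddHaarMeasure] {r : ℝ} (hr : 0 < r) (w : F)
    (f : F → ℝ≥0∞) :
    ∫⁻ u, f (r • u + w) ∂μ = ENNReal.ofReal ((r ^ Module.finrank ℝ F)⁻¹) * ∫⁻ u, f u ∂μ := by
  have h := lintegral_map_equiv (μ := μ) f (dilation r hr.ne' w).toMeasurableEquiv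
  rw [Homeomorph.toMeasurableEquiv_coe, map_dilation_addHaar μ hr, lintegral_smul_measure] at h
  exact h.symm

end dilation

section ballDeriv

variable {m : ℕ} (θ : Measure (EuclideanSpace ℝ (Fin m)))

theorem ballDeriv_smul {c : ℝ≥0∞} (hc : c ≠ ⊤) (u : EuclideanSpace ℝ (Fin m)) :
    ballDeriv (c • θ) u = c * ballDeriv θ u := by
  simp only [ballDeriv, Measure.smul_apply, smul_eq_mul, mul_div_assoc]
  exact ENNReal.limsup_const_mul_of_ne_top hc

theorem ballDeriv_map_dilation_symm {r : ℝ} (hr : 0 < r) (w u : EuclideanSpace ℝ (Fin m)) :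
    ballDeriv (θ.map (dilation r hr.ne' w).symm) u =
      ENNReal.ofReal (r ^ m) * ballDeriv θ (r • u + w) := by
  have hmap : Filter.map (fun δ : ℝ => r * δ) (𝓝[>] 0) = 𝓝[>] 0 := by
    have h1 := comap_mulLeft_nhdsGT_zero hr
    conv_lhs => rw [← h1]
    exact Filter.map_comap_of_surjective (mul_left_surjective₀ hr.ne') _
  unfold ballDeriv
  rw [← ENNReal.limsup_const_mul_of_ne_top ENNReal.ofReal_ne_top]
  conv_rhs => rw [← hmap, ← limsup_comp]
  refine limsup_congr ?_
  filter_upwards [self_mem_nhdsWithin] with δ hδ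
  have hδ : 0 < δ := hδ
  rw [Function.comp_apply, Measure.map_apply (dilation r hr.ne' w).symm.continuous.measurable
    Metric.isClosed_closedBall.measurableSet, dilation_symm_preimage_closedBall hr,
    Measure.addHaar_closedBall' volume (r • u + w) (mul_pos hr hδ).le,
    Measure.addHaar_closedBall' volume u hδ.le]
  simp only [finrank_euclideanSpace, Fintype.card_fin]
  rw [mul_pow, ENNReal.ofReal_mul (by positivity), mul_assoc, ← mul_div_assoc,
    ENNReal.mul_div_mul_left _ _ (ENNReal.ofReal_pos.2 (by positivity)).ne' ENNReal.ofReal_ne_top]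

/-- The squared density scales by r^(2m) and the change of variables by r^(-m). -/
theorem lintegral_ballDeriv_sq_smul_map_dilation_symm {c : ℝ≥0∞} (hc : c ≠ ⊤) {r : ℝ} (hr : 0 < r)
    (w : EuclideanSpace ℝ (Fin m)) :
    ∫⁻ u, ballDeriv (c • θ.map (dilation r hr.ne' w).symm) u ^ 2 =
      c ^ 2 * ENNReal.ofReal (r ^ m) * ∫⁻ u, ballDeriv θ u ^ 2 := by
  simp only [ballDeriv_smul _ hc, ballDeriv_map_dilation_symm _ hr]
  have h := lintegral_comp_dilation volume hr w
    fun u => (c * (ENNReal.ofReal (r ^ m) * ballDeriv θ u)) ^ 2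
  rw [h, finrank_euclideanSpace, Fintype.card_fin]
  simp only [mul_pow, ← mul_assoc]
  rw [lintegral_const_mul' _ _ (by finiteness), ← mul_assoc]
  congr 1
  have h2 : ENNReal.ofReal (r ^ m)⁻¹ * ENNReal.ofReal (r ^ m) = 1 := by
    rw [← ENNReal.ofReal_mul (by positivity), inv_mul_cancel₀ (by positivity), ENNReal.ofReal_one]
  calc ENNReal.ofReal (r ^ m)⁻¹ * (c ^ 2 * ENNReal.ofReal (r ^ m) ^ 2)
      = c ^ 2 * ENNReal.ofReal (r ^ m) * (ENNReal.ofReal (r ^ m)⁻¹ * ENNReal.ofReal (r ^ m)) := by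
        ring
    _ = _ := by rw [h2, mul_one]

theorem absolutelyContinuous_of_smul_map_dilation_symm {c : ℝ≥0∞} (hc : c ≠ 0) {r : ℝ}
    (hr : 0 < r) (w : EuclideanSpace ℝ (Fin m))
    (h : c • θ.map (dilation r hr.ne' w).symm ≪ volume) : θ ≪ volume := by
  have h1 : θ.map (dilation r hr.ne' w).symm ≪ volume :=
    (Measure.absolutelyContinuous_smul hc).trans h
  have hm := (dilation r hr.ne' w).continuous.measurable
  have h2 := h1.map hm
  rw [Measure.map_map hm (dilation r hr.ne' w).symm.continuous.measurable,
    Homeomorph.self_comp_symm, Measure.map_id, map_dilation_addHaar volume hr] at h2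
  exact h2.trans Measure.smul_absolutelyContinuous

theorem ballDeriv_zero (u : EuclideanSpace ℝ (Fin m)) : ballDeriv 0 u = 0 := by
  simp [ballDeriv]

end ballDeriv

/-- The part of `μ` in `B(a, r)`, rescaled to the unit ball. -/
noncomputable def rescale {n : ℕ} (μ : Measure (EuclideanSpace ℝ (Fin n))) (c : ℝ≥0∞)
    (a : EuclideanSpace ℝ (Fin n)) (r : ℝ) (hr : r ≠ 0) : Measure (EuclideanSpace ℝ (Fin n)) :=
  c • (μ.restrict (Metric.closedBall a r)).map (dilation r hr a).symm

section rescale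

variable {n : ℕ} (μ : Measure (EuclideanSpace ℝ (Fin n))) (a : EuclideanSpace ℝ (Fin n)) {r : ℝ} (hr : 0 < r)
include hr

theorem isCompactlySupportedIn_rescale [IsFiniteMeasure μ] {c : ℝ≥0∞} (hc0 : c ≠ 0) (hc : c ≠ ⊤)
    (h0 : μ.restrict (Metric.closedBall a r) ≠ 0) :
    IsCompactlySupportedIn (rescale μ c a r hr.ne') (Metric.closedBall 0 1) := by
  have hmeas := (dilation r hr.ne' a).symm.continuous.measurable
  have hsub : (rescale μ c a r hr.ne').support ⊆ Metric.closedBall 0 1 := by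
    refine Measure.support_subset_of_isClosed Metric.isClosed_closedBall ?_
    rw [mem_ae_iff, rescale, Measure.smul_apply, Measure.map_apply hmeas
      Metric.isClosed_closedBall.measurableSet.compl, preimage_compl,
      dilation_symm_preimage_closedBall hr, smul_zero, zero_add, mul_one,
      Measure.restrict_apply Metric.isClosed_closedBall.measurableSet.compl]
    simp
  refine ⟨?_, ?_, ?_, hsub⟩
  · intro h
    refine h0 ?_
    rw [← Measure.measure_univ_eq_zero] at h ⊢
    rw [rescale, Measure.smul_apply, Measure.map_apply hmeas MeasurableSet.univ] at h
    simpa [hc0] using h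
  · have := Measure.smul_finite ((μ.restrict (Metric.closedBall a r)).map
      (dilation r hr.ne' a).symm) hc
    exact this
  · exact (isCompact_closedBall _ _).of_isClosed_subset Measure.isClosed_support hsub

/-- The normalisation (K r^s)⁻¹ is exactly what turns the bound K (rρ)^s at scale rρ into ρ^s. -/
theorem isFrostman_rescale {s K : ℝ} (hK : 0 < K)
    (hμ : ∀ x, ∀ ρ : ℝ, 0 < ρ → μ (Metric.closedBall x ρ) ≤ ENNReal.ofReal (K * ρ ^ s)) :
    IsFrostman (rescale μ (ENNReal.ofReal (K * r ^ s)⁻¹) a r hr.ne') s := by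
  intro x ρ hρ
  have hmeas := (dilation r hr.ne' a).symm.continuous.measurable
  rw [rescale, Measure.smul_apply, smul_eq_mul,
    Measure.map_apply hmeas Metric.isClosed_closedBall.measurableSet,
    dilation_symm_preimage_closedBall hr]
  have h1 := (Measure.restrict_apply_le (μ := μ) (Metric.closedBall a r)
    (Metric.closedBall (r • x + a) (r * ρ))).trans (hμ _ _ (mul_pos hr hρ))
  refine (mul_le_mul_right h1 _).trans (le_of_eq ?_)
  rw [← ENNReal.ofReal_mul (by positivity), Real.mul_rpow hr.le hρ.le]
  congr 1
  field_simp

end rescale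

theorem pushProd_zero_left {n p m : ℕ} (P : EuclProd n p →L[ℝ] EuclideanSpace ℝ (Fin m))
    (ν : Measure (EuclideanSpace ℝ (Fin p))) : pushProd P 0 ν = 0 := by
  simp [pushProd]

theorem pushProd_zero_right {n p m : ℕ} (P : EuclProd n p →L[ℝ] EuclideanSpace ℝ (Fin m))
    (μ : Measure (EuclideanSpace ℝ (Fin n))) [SFinite μ] : pushProd P μ 0 = 0 := by
  simp [pushProd]

theorem measurable_pushProd_map {n p m : ℕ} (P : EuclProd n p →L[ℝ] EuclideanSpace ℝ (Fin m)) :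
    Measurable fun z : EuclideanSpace ℝ (Fin n) × EuclideanSpace ℝ (Fin p) =>
      P (WithLp.toLp 2 z) :=
  P.continuous.measurable.comp (WithLp.measurable_toLp 2 _)

/-- By linearity P(r z + (a, b)) = r P z + P(a, b). The same r must therefore be used in both
factors, whatever their dimensions s and t. -/
theorem pushProd_rescale {n p m : ℕ} (P : EuclProd n p →L[ℝ] EuclideanSpace ℝ (Fin m))
    (μ : Measure (EuclideanSpace ℝ (Fin n))) (ν : Measure (EuclideanSpace ℝ (Fin p)))
    [IsFiniteMeasure μ] [IsFiniteMeasure ν] {c c' : ℝ≥0∞} (hc' : c' ≠ ⊤)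
    (a : EuclideanSpace ℝ (Fin n)) (b : EuclideanSpace ℝ (Fin p)) {r : ℝ} (hr : r ≠ 0) :
    pushProd P (rescale μ c a r hr) (rescale ν c' b r hr) =
      (c * c') • (pushProd P (μ.restrict (Metric.closedBall a r))
        (ν.restrict (Metric.closedBall b r))).map
          (dilation r hr (P (WithLp.toLp 2 (a, b)))).symm := by
  have h1 := (dilation r hr a).symm.continuous.measurable
  have h2 := (dilation r hr b).symm.continuous.measurable
  have h3 := (dilation r hr (P (WithLp.toLp 2 (a, b)))).symm.continuous.measurable
  have hP := measurable_pushProd_map P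
  have := Measure.smul_finite ((ν.restrict (Metric.closedBall b r)).map (dilation r hr b).symm) hc'
  unfold pushProd rescale
  rw [Measure.prod_smul_left, Measure.prod_smul_right, Measure.map_smul, Measure.map_smul,
    smul_smul, Measure.map_prod_map _ _ h1 h2, Measure.map_map hP (h1.prodMap h2),
    Measure.map_map h3 hP]
  congr 2
  funext z
  obtain ⟨x, y⟩ := z
  obtain ⟨x, rfl⟩ := (dilation r hr a).surjective x
  obtain ⟨y, rfl⟩ := (dilation r hr b).surjective y
  rw [Function.comp_apply, Function.comp_apply, Homeomorph.eq_symm_apply]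
  rw [Prod.map_apply, Homeomorph.symm_apply_apply, Homeomorph.symm_apply_apply]
  simp only [dilation_apply]
  rw [← map_smul, ← map_add]
  rfl

section energy

variable {n p m : ℕ} {Λ : Type*} [MeasurableSpace Λ] (ω : Measure Λ)
  (P : Λ → EuclProd n p →L[ℝ] EuclideanSpace ℝ (Fin m)) {s t : ℝ}
  (μ : Measure (EuclideanSpace ℝ (Fin n))) (ν : Measure (EuclideanSpace ℝ (Fin p)))
  [IsFiniteMeasure μ] [IsFiniteMeasure ν] {K K' : ℝ} (hK : 0 < K) (hK' : 0 < K')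
  (hμ : ∀ x, ∀ ρ : ℝ, 0 < ρ → μ (Metric.closedBall x ρ) ≤ ENNReal.ofReal (K * ρ ^ s))
  (hν : ∀ x, ∀ ρ : ℝ, 0 < ρ → ν (Metric.closedBall x ρ) ≤ ENNReal.ofReal (K' * ρ ^ t))
  (a : EuclideanSpace ℝ (Fin n)) (b : EuclideanSpace ℝ (Fin p)) {r : ℝ} (hr : 0 < r)
include hK hK' hμ hν hr

/-- Absolute continuity is invariant under dilation, so it may be checked after rescaling to the
unit ball. Vanishing restrictions are treated apart because the hypothesis concerns non-zero
measures. -/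
theorem ae_pushProd_restrict_absolutelyContinuous
    (hac : ∀ (μ : Measure (EuclideanSpace ℝ (Fin n))) (ν : Measure (EuclideanSpace ℝ (Fin p))),
      IsCompactlySupportedIn μ (Metric.closedBall 0 1) →
      IsCompactlySupportedIn ν (Metric.closedBall 0 1) →
      IsFrostman μ s → IsFrostman ν t →
      ∀ᵐ l ∂ω, pushProd (P l) μ ν ≪ volume) :
    ∀ᵐ l ∂ω, pushProd (P l) (μ.restrict (Metric.closedBall a r))
      (ν.restrict (Metric.closedBall b r)) ≪ volume := by
  by_cases h1 : μ.restrict (Metric.closedBall a r) = 0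
  · simp [h1, pushProd_zero_left, Measure.AbsolutelyContinuous.zero]
  by_cases h2 : ν.restrict (Metric.closedBall b r) = 0
  · simp [h2, pushProd_zero_right, Measure.AbsolutelyContinuous.zero]
  have hc : ENNReal.ofReal (K * r ^ s)⁻¹ ≠ 0 := (ENNReal.ofReal_pos.2 (by positivity)).ne'
  have hc' : ENNReal.ofReal (K' * r ^ t)⁻¹ ≠ 0 := (ENNReal.ofReal_pos.2 (by positivity)).ne'
  filter_upwards [hac _ _ (isCompactlySupportedIn_rescale μ a hr hc ENNReal.ofReal_ne_top h1)
    (isCompactlySupportedIn_rescale ν b hr hc' ENNReal.ofReal_ne_top h2)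
    (isFrostman_rescale μ a hr hK hμ) (isFrostman_rescale ν b hr hK' hν)] with l hl
  rw [pushProd_rescale _ _ _ ENNReal.ofReal_ne_top] at hl
  exact absolutelyContinuous_of_smul_map_dilation_symm _ (mul_ne_zero hc hc') hr _ hl

/-- Rescaling multiplies the integral by r^m / (K r^s K' r^t)², and the rescaled integral is below
`C`. It is essential that `C` does not depend on the measures: the bound is summed over many boxes
at every scale. -/
theorem lintegral_ballDeriv_sq_pushProd_restrict_le {C : ℝ}
    (hL2 : ∀ (μ : Measure (EuclideanSpace ℝ (Fin n))) (ν : Measure (EuclideanSpace ℝ (Fin p))),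
      IsCompactlySupportedIn μ (Metric.closedBall 0 1) →
      IsCompactlySupportedIn ν (Metric.closedBall 0 1) →
      IsFrostman μ s → IsFrostman ν t →
      ∫⁻ l, ∫⁻ u, ballDeriv (pushProd (P l) μ ν) u ^ 2 ∂volume ∂ω < ENNReal.ofReal C) :
    ∫⁻ l, ∫⁻ u, ballDeriv (pushProd (P l) (μ.restrict (Metric.closedBall a r))
      (ν.restrict (Metric.closedBall b r))) u ^ 2 ∂volume ∂ω ≤
      ENNReal.ofReal (C * (K * K') ^ 2 * r ^ (2 * (s + t) - m)) := by
  by_cases h1 : μ.restrict (Metric.closedBall a r) = 0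
  · simp [h1, pushProd_zero_left, ballDeriv_zero]
  by_cases h2 : ν.restrict (Metric.closedBall b r) = 0
  · simp [h2, pushProd_zero_right, ballDeriv_zero]
  have hc : ENNReal.ofReal (K * r ^ s)⁻¹ ≠ 0 := (ENNReal.ofReal_pos.2 (by positivity)).ne'
  have hc' : ENNReal.ofReal (K' * r ^ t)⁻¹ ≠ 0 := (ENNReal.ofReal_pos.2 (by positivity)).ne'
  have h := hL2 _ _ (isCompactlySupportedIn_rescale μ a hr hc ENNReal.ofReal_ne_top h1)
    (isCompactlySupportedIn_rescale ν b hr hc' ENNReal.ofReal_ne_top h2)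
    (isFrostman_rescale μ a hr hK hμ) (isFrostman_rescale ν b hr hK' hν)
  simp only [pushProd_rescale _ _ _ ENNReal.ofReal_ne_top,
    lintegral_ballDeriv_sq_smul_map_dilation_symm _
      (ENNReal.mul_ne_top ENNReal.ofReal_ne_top ENNReal.ofReal_ne_top) hr] at h
  rw [lintegral_const_mul' _ _ (by finiteness), ← ENNReal.ofReal_mul (by positivity),
    ← ENNReal.ofReal_pow (by positivity), ← ENNReal.ofReal_mul (by positivity)] at h
  set D := ((K * r ^ s)⁻¹ * (K' * r ^ t)⁻¹) ^ 2 * r ^ m with hD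
  have hD0 : 0 < D := by positivity
  have h3 := ENNReal.le_div_iff_mul_le (Or.inl (ENNReal.ofReal_pos.2 hD0).ne')
    (Or.inl ENNReal.ofReal_ne_top) |>.2 ((mul_comm _ _).trans_le h.le)
  refine h3.trans (le_of_eq ?_)
  rw [← ENNReal.ofReal_div_of_pos hD0]
  congr 1
  rw [hD, Real.rpow_sub hr, Real.rpow_natCast, mul_comm 2 (s + t), Real.rpow_mul hr.le,
    Real.rpow_add hr]
  have : (r ^ s * r ^ t) ^ (2 : ℝ) = (r ^ s * r ^ t) ^ 2 := by
    rw [← Real.rpow_natCast]; norm_num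
  rw [this]
  field_simp

end energy

/-! ### Slice densities and disintegration -/

/-- The density at `u` of the push-forward of `M` under `f(l, ·)`, as a function of `(l, u)`. -/
noncomputable def sliceDensity {Λ Z : Type*} [MeasurableSpace Z] {m : ℕ}
    (f : Λ × Z → EuclideanSpace ℝ (Fin m)) (M : Measure Z)
    (q : Λ × EuclideanSpace ℝ (Fin m)) : ℝ≥0∞ :=
  limsup (fun k : ℕ => M {z | dist (f (q.1, z)) q.2 ≤ 1 / ((k : ℝ) + 1)} /
    volume (Metric.closedBall q.2 (1 / ((k : ℝ) + 1)))) atTop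

theorem ae_ballDeriv_eq_rnDeriv {m : ℕ} (θ : Measure (EuclideanSpace ℝ (Fin m)))
    [IsFiniteMeasure θ] : ∀ᵐ u, ballDeriv θ u = θ.rnDeriv volume u := by
  filter_upwards [Besicovitch.ae_tendsto_rnDeriv θ volume] with u hu
  exact hu.limsup_eq

section slices

variable {Λ Z : Type*} [MeasurableSpace Λ] [MeasurableSpace Z] {m : ℕ} (ω : Measure Λ)
  {f : Λ × Z → EuclideanSpace ℝ (Fin m)} (hf : Measurable f) (M : Measure Z)
include hf

/-- The upper limit runs over the countable sequence of radii 1/(k + 1), and each ratio is jointly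
measurable in (l, u) by Fubini. -/
theorem measurable_sliceDensity [IsFiniteMeasure M] : Measurable (sliceDensity f M) := by
  refine Measurable.limsup fun k => ?_
  have h : MeasurableSet {p : (Λ × EuclideanSpace ℝ (Fin m)) × Z |
      dist (f (p.1.1, p.2)) p.1.2 ≤ 1 / ((k : ℝ) + 1)} :=
    measurableSet_le ((hf.comp (measurable_fst.fst.prodMk measurable_snd)).dist
      measurable_fst.snd) measurable_const
  refine (measurable_measure_prodMk_left (ν := M) h).div ?_
  have : ∀ q : Λ × EuclideanSpace ℝ (Fin m),
      volume (Metric.closedBall q.2 (1 / ((k : ℝ) + 1))) =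
      volume (Metric.closedBall (0 : EuclideanSpace ℝ (Fin m)) (1 / ((k : ℝ) + 1))) :=
    fun q => Measure.addHaar_closedBall_center _ _ _
  simp only [this]
  exact measurable_const

theorem ae_sliceDensity_eq_rnDeriv [IsFiniteMeasure M] (l : Λ) :
    ∀ᵐ u, sliceDensity f M (l, u) = (M.map fun z => f (l, z)).rnDeriv volume u := by
  have hfl : Measurable fun z => f (l, z) := hf.comp measurable_prodMk_left
  filter_upwards [Besicovitch.ae_tendsto_rnDeriv (M.map fun z => f (l, z)) volume] with u hu
  have h1 : Tendsto (fun k : ℕ => 1 / ((k : ℝ) + 1)) atTop (𝓝[>] 0) :=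
    tendsto_nhdsWithin_iff.2 ⟨tendsto_one_div_add_atTop_nhds_zero_nat,
      Eventually.of_forall fun k => mem_Ioi.2 (by positivity)⟩
  rw [← (hu.comp h1).limsup_eq, sliceDensity]
  refine limsup_congr (Eventually.of_forall fun k => ?_)
  rw [Function.comp_apply, Measure.map_apply hfl Metric.isClosed_closedBall.measurableSet]
  rfl

theorem lintegral_sliceDensity_sq [IsFiniteMeasure M] :
    ∫⁻ q, sliceDensity f M q ^ 2 ∂(ω.prod volume) =
      ∫⁻ l, ∫⁻ u, ballDeriv (M.map fun z => f (l, z)) u ^ 2 ∂volume ∂ω := by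
  rw [lintegral_prod _ ((measurable_sliceDensity hf M).pow_const 2).aemeasurable]
  refine lintegral_congr fun l => lintegral_congr_ae ?_
  filter_upwards [ae_sliceDensity_eq_rnDeriv hf M l,
    ae_ballDeriv_eq_rnDeriv (M.map fun z => f (l, z))] with u h1 h2
  rw [h1, h2]

/-- Fubini reduces this to the Radon-Nikodym theorem for almost every l. In particular the law of
(l, f(l, z)) does not charge null sets of ω × ℒᵐ. -/
theorem map_prodMk_eq_withDensity_sliceDensity [IsFiniteMeasure M]
    (hac : ∀ᵐ l ∂ω, (M.map fun z => f (l, z)) ≪ volume) :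
    (ω.prod M).map (fun p => (p.1, f p)) =
      (ω.prod volume).withDensity (sliceDensity f M) := by
  ext S hS
  have hg := measurable_sliceDensity hf M
  rw [Measure.map_apply (measurable_fst.prodMk hf) hS,
    Measure.prod_apply ((measurable_fst.prodMk hf) hS), withDensity_apply _ hS,
    ← lintegral_indicator hS, lintegral_prod _ (hg.indicator hS).aemeasurable]
  refine lintegral_congr_ae ?_
  filter_upwards [hac] with l hl
  have hfl : Measurable fun z => f (l, z) := hf.comp measurable_prodMk_left
  have hSl : MeasurableSet (Prod.mk l ⁻¹' S) := measurable_prodMk_left hS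
  have h1 : M (Prod.mk l ⁻¹' ((fun p => (p.1, f p)) ⁻¹' S)) =
      (M.map fun z => f (l, z)) (Prod.mk l ⁻¹' S) := by
    rw [Measure.map_apply hfl hSl]; rfl
  rw [h1, ← Measure.withDensity_rnDeriv_eq _ _ hl, withDensity_apply _ hSl,
    ← lintegral_indicator hSl]
  refine lintegral_congr_ae ?_
  filter_upwards [ae_sliceDensity_eq_rnDeriv hf M l] with u hu
  have h2 : S.indicator (sliceDensity f M) (l, u) =
      (Prod.mk l ⁻¹' S).indicator (fun v => sliceDensity f M (l, v)) u := rfl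
  rw [h2]
  by_cases h : u ∈ Prod.mk l ⁻¹' S
  · rw [indicator_of_mem h, indicator_of_mem h, hu]
  · rw [indicator_of_notMem h, indicator_of_notMem h]

theorem map_restrict_absolutelyContinuous {l : Λ} (h : (M.map fun z => f (l, z)) ≪ volume)
    (Q : Set Z) : ((M.restrict Q).map fun z => f (l, z)) ≪ volume :=
  (Measure.absolutelyContinuous_of_le (Measure.map_mono Measure.restrict_le_self
    (hf.comp measurable_prodMk_left))).trans h

theorem fst_map_graph :
    ((ω.prod M).map fun p => ((p.1, f p), p.2)).fst = (ω.prod M).map fun p => (p.1, f p) := by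
  rw [Measure.fst, Measure.map_map measurable_fst
    ((measurable_fst.prodMk hf).prodMk measurable_snd)]
  rfl

/-- Both sides are densities, with respect to ω × ℒᵐ, of the law of (l, f(l, z)) under ω × M|Q.
Densities of a finite measure are unique almost everywhere. -/
theorem ae_sliceDensity_restrict_eq [IsFiniteMeasure ω] [IsFiniteMeasure M]
    [StandardBorelSpace Z] [Nonempty Z] (hac : ∀ᵐ l ∂ω, (M.map fun z => f (l, z)) ≪ volume)
    {Q : Set Z} (hQ : MeasurableSet Q) :
    ∀ᵐ q ∂(ω.prod volume), sliceDensity f (M.restrict Q) q =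
      sliceDensity f M q * ((ω.prod M).map fun p => ((p.1, f p), p.2)).condKernel q Q := by
  set R := (ω.prod M).map fun p => ((p.1, f p), p.2) with hR
  have hmeas : Measurable fun p : Λ × Z => ((p.1, f p), p.2) :=
    (measurable_fst.prodMk hf).prodMk measurable_snd
  have hκ : Measurable fun q => R.condKernel q Q := ProbabilityTheory.Kernel.measurable_coe _ hQ
  have hg := measurable_sliceDensity hf M
  have hgQ := measurable_sliceDensity hf (M.restrict Q)
  have hacQ : ∀ᵐ l ∂ω, ((M.restrict Q).map fun z => f (l, z)) ≪ volume := by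
    filter_upwards [hac] with l hl using map_restrict_absolutelyContinuous hf M hl Q
  have hmapQ := map_prodMk_eq_withDensity_sliceDensity ω hf (M.restrict Q) hacQ
  refine (withDensity_eq_iff hgQ.aemeasurable (hg.mul hκ).aemeasurable ?_).1 ?_
  · rw [← setLIntegral_univ, ← withDensity_apply _ MeasurableSet.univ, ← hmapQ]
    exact measure_ne_top _ _
  · ext S hS
    rw [← hmapQ, withDensity_apply _ hS,
      ← setLIntegral_withDensity_eq_setLIntegral_mul _ hg hκ hS,
      ← map_prodMk_eq_withDensity_sliceDensity ω hf M hac, ← fst_map_graph ω hf M,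
      Measure.setLIntegral_condKernel_eq_measure_prod hS hQ,
      Measure.map_apply hmeas (hS.prod hQ), Measure.map_apply (measurable_fst.prodMk hf) hS]
    have h1 : (fun p : Λ × Z => ((p.1, f p), p.2)) ⁻¹' S ×ˢ Q =
        (fun p => (p.1, f p)) ⁻¹' S ∩ (univ ×ˢ Q) := by
      ext p; simp
    rw [h1, ← Measure.restrict_apply ((measurable_fst.prodMk hf) hS), ← Measure.prod_restrict,
      Measure.restrict_univ]

end slices

/-- If the push-forwards of `M` under `f(l, ·)` are absolutely continuous and those of the
restrictions of `M` to small sets have densities with controlled `L²` norms, then almost all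
fibres meet every carrier of `M` in a set of dimension at least `τ`. -/
theorem ae_le_dimH_fiber {Λ Z : Type*} [MeasurableSpace Λ] (ω : Measure Λ) [IsFiniteMeasure ω]
    [MetricSpace Z] [MeasurableSpace Z] [BorelSpace Z] [StandardBorelSpace Z] [Nonempty Z]
    {m : ℕ} {f : Λ × Z → EuclideanSpace ℝ (Fin m)} (hf : Measurable f)
    (M : Measure Z) [IsFiniteMeasure M] (hac : ∀ᵐ l ∂ω, (M.map fun z => f (l, z)) ≪ volume)
    {D : Set Z} (hD : MeasurableSet D) (hDM : ∀ᵐ z ∂M, z ∈ D) {τ : NNReal} (hτ : 0 < τ)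
    {r₀ : ℝ} (hr₀ : 0 < r₀) (ι : ℕ → Type*) [∀ k, Countable (ι k)] (Q : ∀ k, ι k → Set Z)
    (hQ : ∀ k i, MeasurableSet (Q k i))
    (hcov : ∀ k, ∀ z ∈ D, ∃ i, Metric.closedBall z (r₀ * (1 / 2) ^ k) ⊆ Q k i)
    (hsum : ∑' k, ENNReal.ofReal ((2 ^ k) ^ (τ : ℝ)) * ∑' i, ∫⁻ l, ∫⁻ u,
      ballDeriv ((M.restrict (Q k i)).map fun z => f (l, z)) u ^ 2 ∂volume ∂ω ≠ ⊤) :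
    ∀ᵐ p ∂(ω.prod M), (τ : ℝ≥0∞) ≤ dimH (D ∩ {z | f (p.1, z) = f p}) := by
  set R := (ω.prod M).map fun p => ((p.1, f p), p.2) with hR
  have hmeas : Measurable fun p : Λ × Z => ((p.1, f p), p.2) :=
    (measurable_fst.prodMk hf).prodMk measurable_snd
  have hfst : R.fst = (ω.prod M).map fun p => (p.1, f p) := fst_map_graph ω hf M
  have hdens : R.fst = (ω.prod volume).withDensity (sliceDensity f M) :=
    hfst.trans (map_prodMk_eq_withDensity_sliceDensity ω hf M hac)
  have hg := measurable_sliceDensity hf M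
  -- finiteness of the discrete energies
  have hgQ : ∀ k i, Measurable fun q => sliceDensity f (M.restrict (Q k i)) q ^ 2 := fun k i =>
    (measurable_sliceDensity hf _).pow_const 2
  have hE : ∀ᵐ q ∂(ω.prod volume), ∑' k, ENNReal.ofReal ((2 ^ k) ^ (τ : ℝ)) *
      ∑' i, sliceDensity f (M.restrict (Q k i)) q ^ 2 < ⊤ := by
    refine ae_lt_top (Measurable.tsum fun k =>
      (Measurable.tsum fun i => hgQ k i).const_mul _) ?_
    rw [lintegral_tsum fun k => ((Measurable.tsum fun i => hgQ k i).const_mul _).aemeasurable]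
    simp only [lintegral_const_mul _ (Measurable.tsum fun i => hgQ _ i),
      lintegral_tsum fun i => (hgQ _ i).aemeasurable, lintegral_sliceDensity_sq ω hf]
    exact hsum
  have hprod : ∀ᵐ q ∂(ω.prod volume), ∀ k i, sliceDensity f (M.restrict (Q k i)) q =
      sliceDensity f M q * R.condKernel q (Q k i) :=
    ae_all_iff.2 fun k => ae_all_iff.2 fun i => ae_sliceDensity_restrict_eq ω hf M hac (hQ k i)
  have hfin : ∀ᵐ q ∂(R.fst), ∑' k, ENNReal.ofReal ((2 ^ k) ^ (τ : ℝ)) *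
      ∑' i, R.condKernel q (Q k i) ^ 2 ≠ ⊤ := by
    -- `R.fst` does not charge the zeros of its density, so the squared density can be cancelled
    -- from the finite sum.
    rw [hdens, ae_withDensity_iff hg]
    filter_upwards [hE, hprod] with q h1 h2 h0
    simp only [h2, mul_pow, ENNReal.tsum_mul_left, mul_left_comm (ENNReal.ofReal _)] at h1
    exact (ENNReal.lt_top_of_mul_ne_top_right h1.ne (pow_ne_zero 2 h0)).ne
  -- the conditional measures are carried by the fibres
  have hH : MeasurableSet {x : (Λ × EuclideanSpace ℝ (Fin m)) × Z |
      x.2 ∈ D ∧ f (x.1.1, x.2) = x.1.2} :=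
    (measurable_snd hD).inter (measurableSet_eq_fun
      (hf.comp (measurable_fst.fst.prodMk measurable_snd)) measurable_fst.snd)
  have hfib : ∀ᵐ q ∂(R.fst), ∀ᵐ z ∂(R.condKernel q), z ∈ D ∧ f (q.1, z) = q.2 := by
    refine Measure.ae_ae_of_ae_compProd
      (p := fun x : (Λ × EuclideanSpace ℝ (Fin m)) × Z =>
        x.2 ∈ D ∧ f (x.1.1, x.2) = x.1.2) ?_
    rw [R.disintegrate, hR, ae_map_iff hmeas.aemeasurable hH]
    have : ∀ᵐ p ∂(ω.prod M), p.2 ∈ D := Measure.quasiMeasurePreserving_snd.ae hDM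
    filter_upwards [this] with p hp using ⟨hp, rfl⟩
  have hdim : ∀ᵐ q ∂(R.fst), (τ : ℝ≥0∞) ≤ dimH (D ∩ {z | f (q.1, z) = q.2}) := by
    filter_upwards [hfin, hfib] with q h1 h2
    refine le_dimH_of_tsum_measure_sq_ne_top (R.condKernel q) hD ?_ hτ hr₀ ι Q hQ hcov h1
    have h3 : R.condKernel q (D ∩ {z | f (q.1, z) = q.2}) = 1 := by
      refine (prob_compl_eq_zero_iff₀ ?_).1 h2
      exact (hD.inter (measurableSet_eq_fun (hf.comp measurable_prodMk_left)
        measurable_const)).nullMeasurableSet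
    rw [h3]; exact one_ne_zero
  rw [hfst] at hdim
  exact ae_of_ae_map (measurable_fst.prodMk hf).aemeasurable hdim

/-! ### Orthogonal projections and the product space -/

section projections

variable {n p m : ℕ}

/-- P P* = id makes P* isometric, and P has the same norm as P*. -/
theorem IsOrthProj.lipschitzWith {P : EuclProd n p →L[ℝ] EuclideanSpace ℝ (Fin m)}
    (hP : IsOrthProj P) : LipschitzWith 1 P := by
  have h1 : ‖ContinuousLinearMap.adjoint P‖ ≤ 1 := by
    refine ContinuousLinearMap.opNorm_le_bound _ zero_le_one fun u => ?_
    have h := ContinuousLinearMap.apply_norm_sq_eq_inner_adjoint_left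
      (ContinuousLinearMap.adjoint P) u
    rw [ContinuousLinearMap.adjoint_adjoint, hP, ContinuousLinearMap.id_apply,
      real_inner_self_eq_norm_sq] at h
    rw [one_mul]
    exact ((sq_eq_sq₀ (norm_nonneg _) (norm_nonneg _)).1 h).le
  rw [LinearIsometryEquiv.norm_map] at h1
  exact P.lipschitz.weaken h1

/-- Continuity in l together with the Lipschitz bound in z, uniform in l, gives joint continuity. -/
theorem measurable_uncurry_of_isOrthProj {Λ : Type*} [MetricSpace Λ] [MeasurableSpace Λ]
    [BorelSpace Λ] {P : Λ → EuclProd n p →L[ℝ] EuclideanSpace ℝ (Fin m)}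
    (hP : ∀ l, IsOrthProj (P l)) (hPcont : ∀ z, Continuous fun l => P l z) :
    Measurable fun x : Λ × EuclProd n p => P x.1 x.2 := by
  have h := continuous_prod_of_continuous_lipschitzWith
    (fun x : EuclProd n p × Λ => P x.2 x.1) 1 hPcont fun l => (hP l).lipschitzWith
  exact (h.comp continuous_swap).measurable

theorem pushProd_eq_map (P : EuclProd n p →L[ℝ] EuclideanSpace ℝ (Fin m))
    (μ : Measure (EuclideanSpace ℝ (Fin n))) (ν : Measure (EuclideanSpace ℝ (Fin p))) :
    pushProd P μ ν = ((μ.prod ν).map (WithLp.toLp 2)).map P := by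
  rw [Measure.map_map P.continuous.measurable (WithLp.measurable_toLp 2 _)]
  rfl

theorem measurableSet_prodSet {A : Set (EuclideanSpace ℝ (Fin n))}
    {B : Set (EuclideanSpace ℝ (Fin p))} (hA : MeasurableSet A) (hB : MeasurableSet B) :
    MeasurableSet (prodSet A B) :=
  (measurable_fst.comp (WithLp.measurable_ofLp 2 _) hA).inter
    (measurable_snd.comp (WithLp.measurable_ofLp 2 _) hB)

theorem restrict_prodSet_map_toLp (μ : Measure (EuclideanSpace ℝ (Fin n)))
    (ν : Measure (EuclideanSpace ℝ (Fin p))) [SFinite μ] [SFinite ν]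
    {A : Set (EuclideanSpace ℝ (Fin n))}
    {B : Set (EuclideanSpace ℝ (Fin p))} (hA : MeasurableSet A) (hB : MeasurableSet B) :
    ((μ.prod ν).map (WithLp.toLp 2)).restrict (prodSet A B) =
      ((μ.restrict A).prod (ν.restrict B)).map (WithLp.toLp 2) := by
  rw [Measure.restrict_map (WithLp.measurable_toLp 2 _) (measurableSet_prodSet hA hB),
    Measure.prod_restrict]
  rfl

theorem dist_toLp_le (x x' : EuclideanSpace ℝ (Fin n)) (y y' : EuclideanSpace ℝ (Fin p)) :
    dist (WithLp.toLp 2 (x, y) : EuclProd n p) (WithLp.toLp 2 (x', y')) ≤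
      dist x x' + dist y y' := by
  rw [WithLp.prod_dist_eq_of_L2]
  refine Real.sqrt_le_iff.2 ⟨by positivity, ?_⟩
  have := mul_nonneg (dist_nonneg (x := x) (y := x')) (dist_nonneg (x := y) (y := y'))
  change dist x x' ^ 2 + dist y y' ^ 2 ≤ _
  nlinarith

theorem dist_fst_le (z w : EuclProd n p) : dist z.fst w.fst ≤ dist z w := by
  rw [WithLp.prod_dist_eq_of_L2]
  exact Real.le_sqrt_of_sq_le (by nlinarith [sq_nonneg (dist z.snd w.snd)])

theorem dist_snd_le (z w : EuclProd n p) : dist z.snd w.snd ≤ dist z w := by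
  rw [WithLp.prod_dist_eq_of_L2]
  exact Real.le_sqrt_of_sq_le (by nlinarith [sq_nonneg (dist z.fst w.fst)])

end projections

/-! ### Upper bound for the dimension of slices -/

/-- Lower mass bounds for a finite measure give power bounds for covering numbers. -/
theorem exists_finset_cover_of_rpow_le_measure_closedBall {X : Type*} [MetricSpace X]
    [MeasurableSpace X] [BorelSpace X] (μ : Measure X) [IsFiniteMeasure μ] {A : Set X}
    {c s ρ : ℝ} (hc : 0 < c)
    (h : ∀ x ∈ A, ∀ r : ℝ, 0 < r → r ≤ ρ →
      ENNReal.ofReal (c * r ^ s) ≤ μ (Metric.closedBall x r)) {r : ℝ} (hr : 0 < r) (hrρ : r ≤ ρ) :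
    ∃ T : Finset X, A ⊆ ⋃ a ∈ T, Metric.closedBall a (2 * r) ∧
      (T.card : ℝ) ≤ μ.real univ / c * r ^ (-s) := by
  obtain ⟨T, -, hT, hcard⟩ := exists_finset_cover_of_le_measure_closedBall μ
    (M := c * r ^ s) (by positivity) fun x hx => h x hx r hr hrρ
  refine ⟨T, hT, hcard.trans (le_of_eq ?_)⟩
  rw [Real.rpow_neg hr.le]
  field_simp

section upper

variable {n p m : ℕ} {s t : ℝ}

/-- At each point one factor has positive lower density and supplies covering numbers. The other is
only used through its null measure in dimension τ - s > t or τ - t > s. Hence the "or" in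
`posDensityPart`. -/
theorem hausdorffMeasure_posDensityPart_eq_zero (hs : 0 < s) (ht : 0 < t)
    {A : Set (EuclideanSpace ℝ (Fin n))} {B : Set (EuclideanSpace ℝ (Fin p))}
    (hA : μH[s] A < ⊤) (hB : μH[t] B < ⊤) {τ : ℝ} (hτ : s + t < τ) :
    μH[τ] (posDensityPart s t A B) = 0 := by
  have : IsFiniteMeasure (μH[s].restrict A) := ⟨by simpa using hA⟩
  have : IsFiniteMeasure (μH[t].restrict B) := ⟨by simpa using hB⟩
  set A' : ℕ → Set (EuclideanSpace ℝ (Fin n)) := fun N => {x ∈ A | ∀ r : ℝ, 0 < r →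
    r ≤ 1 / ((N : ℝ) + 1) → ENNReal.ofReal (1 / ((N : ℝ) + 1) * r ^ s) ≤
      μH[s].restrict A (Metric.closedBall x r)} with hA'
  set B' : ℕ → Set (EuclideanSpace ℝ (Fin p)) := fun N => {x ∈ B | ∀ r : ℝ, 0 < r →
    r ≤ 1 / ((N : ℝ) + 1) → ENNReal.ofReal (1 / ((N : ℝ) + 1) * r ^ t) ≤
      μH[t].restrict B (Metric.closedBall x r)} with hB'
  have hsub : posDensityPart s t A B ⊆
      (⋃ N, image2 (fun x y => (WithLp.toLp 2 (x, y) : EuclProd n p)) (A' N) B) ∪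
      ⋃ N, image2 (fun y x => (WithLp.toLp 2 (x, y) : EuclProd n p)) (B' N) A := by
    rintro z ⟨⟨hzA, hzB⟩, hz | hz⟩
    · obtain ⟨N, hN⟩ := exists_le_hausdorffMeasure_of_lowerDensity_pos hs hz
      exact Or.inl (mem_iUnion.2 ⟨N, z.fst, ⟨hzA, hN⟩, z.snd, hzB, rfl⟩)
    · obtain ⟨N, hN⟩ := exists_le_hausdorffMeasure_of_lowerDensity_pos ht hz
      exact Or.inr (mem_iUnion.2 ⟨N, z.snd, ⟨hzB, hN⟩, z.fst, hzA, rfl⟩)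
  have hA0 : μH[τ - t] A = 0 :=
    (Measure.hausdorffMeasure_zero_or_top (show s < τ - t by linarith) A).resolve_right hA.ne
  have hB0 : μH[τ - s] B = 0 :=
    (Measure.hausdorffMeasure_zero_or_top (show t < τ - s by linarith) B).resolve_right hB.ne
  refine measure_mono_null hsub (measure_union_null (measure_iUnion_null fun N => ?_)
    (measure_iUnion_null fun N => ?_))
  · have hN : (0 : ℝ) < 1 / ((N : ℝ) + 1) := by positivity
    have h := hausdorffMeasure_image2_eq_zero
      (fun x y => (WithLp.toLp 2 (x, y) : EuclProd n p)) dist_toLp_le hs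
      (show 0 < τ - s by linarith) (A := A' N) (B := B) (ρ := 1 / ((N : ℝ) + 1))
      (K := (μH[s].restrict A).real univ / (1 / ((N : ℝ) + 1))) (by positivity) hN
      (fun r hr hrN => exists_finset_cover_of_rpow_le_measure_closedBall _ hN
        (fun x hx => hx.2) hr hrN) hB0
    rwa [add_sub_cancel] at h
  · have hN : (0 : ℝ) < 1 / ((N : ℝ) + 1) := by positivity
    have h := hausdorffMeasure_image2_eq_zero
      (fun y x => (WithLp.toLp 2 (x, y) : EuclProd n p))
      (fun y y' x x' => (dist_toLp_le x x' y y').trans_eq (add_comm _ _)) ht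
      (show 0 < τ - t by linarith) (A := B' N) (B := A) (ρ := 1 / ((N : ℝ) + 1))
      (K := (μH[t].restrict B).real univ / (1 / ((N : ℝ) + 1))) (by positivity) hN
      (fun r hr hrN => exists_finset_cover_of_rpow_le_measure_closedBall _ hN
        (fun x hx => hx.2) hr hrN) hA0
    rwa [add_sub_cancel] at h

/-- The null-slice theorem is applied to the countably many exponents s + t + 1/(k + 1), which
decrease to s + t. -/
theorem ae_dimH_slice_posDensityPart_le {Λ : Type*} [MeasurableSpace Λ]
    (ω : Measure Λ) [IsFiniteMeasure ω] {P : Λ → EuclProd n p →L[ℝ] EuclideanSpace ℝ (Fin m)}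
    (hP : ∀ l, IsOrthProj (P l)) (hPm : ∀ z, Measurable fun l => P l z)
    (hs : 0 < s) (ht : 0 < t) (hst : (m : ℝ) < s + t)
    {A : Set (EuclideanSpace ℝ (Fin n))} {B : Set (EuclideanSpace ℝ (Fin p))}
    (hA : μH[s] A < ⊤) (hB : μH[t] B < ⊤) :
    ∀ᵐ q ∂(ω.prod (volume : Measure (EuclideanSpace ℝ (Fin m)))),
      dimH (P q.1 ⁻¹' {q.2} ∩ posDensityPart s t A B) ≤ ENNReal.ofReal (s + t - m) := by
  have hk : ∀ k : ℕ, (0 : ℝ) < 1 / ((k : ℝ) + 1) := fun k => by positivity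
  have h : ∀ᵐ q ∂(ω.prod (volume : Measure (EuclideanSpace ℝ (Fin m)))), ∀ k : ℕ,
      μH[s + t + 1 / ((k : ℝ) + 1) - m] (P q.1 ⁻¹' {q.2} ∩ posDensityPart s t A B) = 0 :=
    ae_all_iff.2 fun k => ae_hausdorffMeasure_slice_eq_zero ω (fun l => P l)
      (fun l => (hP l).lipschitzWith) hPm (by linarith [hk k])
      (hausdorffMeasure_posDensityPart_eq_zero hs ht hA hB (by linarith [hk k]))
  filter_upwards [h] with q hq
  have hlim : Tendsto (fun k : ℕ => ENNReal.ofReal (s + t + 1 / ((k : ℝ) + 1) - m)) atTop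
      (𝓝 (ENNReal.ofReal (s + t - m))) := by
    refine (ENNReal.continuous_ofReal.tendsto _).comp ?_
    have := (tendsto_one_div_add_atTop_nhds_zero_nat (𝕜 := ℝ)).const_add (s + t)
    simpa using this.sub_const (m : ℝ)
  refine ge_of_tendsto' hlim fun k => ?_
  have h0 : 0 ≤ s + t + 1 / ((k : ℝ) + 1) - m := by linarith [hk k]
  refine dimH_le_of_hausdorffMeasure_ne_top (d := (s + t + 1 / ((k : ℝ) + 1) - m).toNNReal) ?_
  rw [Real.coe_toNNReal _ h0, hq k]
  exact ENNReal.zero_ne_top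

end upper

/-! ### Lower bound for the dimension of slices -/

section lower

variable {n p m : ℕ} {Λ : Type*} [MeasurableSpace Λ] (ω : Measure Λ)
  {P : Λ → EuclProd n p →L[ℝ] EuclideanSpace ℝ (Fin m)} {s t : ℝ}
  (μ : Measure (EuclideanSpace ℝ (Fin n))) (ν : Measure (EuclideanSpace ℝ (Fin p)))
  [IsFiniteMeasure μ] [IsFiniteMeasure ν]
  {E : Set (EuclideanSpace ℝ (Fin n))} {F : Set (EuclideanSpace ℝ (Fin p))}
  (hE : IsRegularPiece μ s E) (hF : IsRegularPiece ν t F)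
  (hac : ∀ (μ : Measure (EuclideanSpace ℝ (Fin n))) (ν : Measure (EuclideanSpace ℝ (Fin p))),
      IsCompactlySupportedIn μ (Metric.closedBall 0 1) →
      IsCompactlySupportedIn ν (Metric.closedBall 0 1) →
      IsFrostman μ s → IsFrostman ν t →
      ∀ᵐ l ∂ω, pushProd (P l) μ ν ≪ volume)
include hE hF hac

theorem ae_map_absolutelyContinuous_of_isRegularPiece :
    ∀ᵐ l ∂ω, (((μ.restrict E).prod (ν.restrict F)).map (WithLp.toLp 2)).map (P l) ≪ volume := by
  obtain ⟨K, hK, hμ⟩ := hE.upper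
  obtain ⟨K', hK', hν⟩ := hF.upper
  obtain ⟨R, hR⟩ := hE.isBounded.subset_closedBall 0
  obtain ⟨R', hR'⟩ := hF.isBounded.subset_closedBall 0
  set r := max (max R R') 1 with hr
  have hr0 : 0 < r := lt_max_of_lt_right one_pos
  have h := ae_pushProd_restrict_absolutelyContinuous ω P (μ.restrict E) (ν.restrict F)
    hK hK' hμ hν 0 0 hr0 hac
  rw [Measure.restrict_eq_self_of_ae_mem ((ae_restrict_mem hE.measurableSet).mono fun x hx =>
      Metric.closedBall_subset_closedBall ((le_max_left _ _).trans (le_max_left _ _)) (hR hx)),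
    Measure.restrict_eq_self_of_ae_mem ((ae_restrict_mem hF.measurableSet).mono fun x hx =>
      Metric.closedBall_subset_closedBall ((le_max_right _ _).trans (le_max_left _ _)) (hR' hx))]
    at h
  simpa only [pushProd_eq_map] using h

/-- At scale r = r₀ 2^(-k) there are O(r^(-s-t)) boxes, each contributing O(r^(2(s+t)-m)). With the
weight 2^(kτ) the sums are dominated by a geometric series of ratio 2^(-(s+t-m-τ)) < 1. -/
theorem ae_le_dimH_slice_of_lt [IsFiniteMeasure ω]
    (hPm : Measurable fun x : Λ × EuclProd n p => P x.1 x.2) {C : ℝ} (hC : 0 < C)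
    (hL2 : ∀ (μ : Measure (EuclideanSpace ℝ (Fin n))) (ν : Measure (EuclideanSpace ℝ (Fin p))),
      IsCompactlySupportedIn μ (Metric.closedBall 0 1) →
      IsCompactlySupportedIn ν (Metric.closedBall 0 1) →
      IsFrostman μ s → IsFrostman ν t →
      ∫⁻ l, ∫⁻ u, ballDeriv (pushProd (P l) μ ν) u ^ 2 ∂volume ∂ω < ENNReal.ofReal C)
    {τ : NNReal} (hτ : 0 < τ) (hτs : (τ : ℝ) < s + t - m) :
    ∀ᵐ x ∂(ω.prod (((μ.restrict E).prod (ν.restrict F)).map (WithLp.toLp 2))),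
      (τ : ℝ≥0∞) ≤ dimH (prodSet E F ∩ {z | P x.1 z = P x.1 x.2}) := by
  obtain ⟨K, hK, hμ⟩ := hE.upper
  obtain ⟨K', hK', hν⟩ := hF.upper
  obtain ⟨c, ρ, hc, hρ, hlow⟩ := hE.lower
  obtain ⟨c', ρ', hc', hρ', hlow'⟩ := hF.lower
  set r₀ := min ρ ρ' with hr₀
  have hr₀0 : 0 < r₀ := lt_min hρ hρ'
  set r : ℕ → ℝ := fun k => r₀ * (1 / 2) ^ k with hr
  have hr0 : ∀ k, 0 < r k := fun k => by positivity
  have hrle : ∀ k, r k ≤ r₀ := fun k =>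
    mul_le_of_le_one_right hr₀0.le (pow_le_one₀ (by norm_num) (by norm_num))
  choose T hT hTc using fun k => exists_finset_cover_of_rpow_le_measure_closedBall μ hc hlow
    (hr0 k) ((hrle k).trans (min_le_left _ _))
  choose T' hT' hTc' using fun k => exists_finset_cover_of_rpow_le_measure_closedBall ν hc' hlow'
    (hr0 k) ((hrle k).trans (min_le_right _ _))
  have hcb : ∀ {N : ℕ} (a : EuclideanSpace ℝ (Fin N)) (R : ℝ),
      MeasurableSet (Metric.closedBall a R) := fun a R => Metric.isClosed_closedBall.measurableSet
  have hD := measurableSet_prodSet hE.measurableSet hF.measurableSet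
  have hac' := ae_map_absolutelyContinuous_of_isRegularPiece ω μ ν hE hF hac
  -- Boxes are used instead of Euclidean balls because restricting a product measure to a box leaves
  -- a product measure. The radius 3r holds an r-ball about any point within 2r of the centre.
  refine ae_le_dimH_fiber ω (f := fun x : Λ × EuclProd n p => P x.1 x.2) hPm _ hac' hD ?_ hτ hr₀0
    (fun k => T k × T' k) (fun k i => prodSet (Metric.closedBall (i.1 : EuclideanSpace ℝ (Fin n))
      (3 * r k)) (Metric.closedBall (i.2 : EuclideanSpace ℝ (Fin p)) (3 * r k)))
    (fun k i => measurableSet_prodSet (hcb _ _) (hcb _ _)) ?_ ?_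
  · rw [← restrict_prodSet_map_toLp _ _ hE.measurableSet hF.measurableSet]
    exact ae_restrict_mem hD
  · rintro k z ⟨hzE, hzF⟩
    obtain ⟨a, ha, hza⟩ := mem_iUnion₂.1 (hT k hzE)
    obtain ⟨b, hb, hzb⟩ := mem_iUnion₂.1 (hT' k hzF)
    refine ⟨⟨⟨a, ha⟩, ⟨b, hb⟩⟩, fun w hw => ?_⟩
    have hw' : dist w z ≤ r k := hw
    rw [Metric.mem_closedBall] at hza hzb
    exact ⟨(dist_triangle _ z.fst _).trans (by linarith [dist_fst_le w z]),
      (dist_triangle _ z.snd _).trans (by linarith [dist_snd_le w z])⟩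
  · set H := C * (K * K') ^ 2 * 3 ^ (2 * (s + t) - m) * (μ.real univ / c) *
      (ν.real univ / c') * r₀ ^ (s + t - m) with hH
    set q : ℝ := (1 / 2) ^ (s + t - m - τ) with hq
    have hq1 : q < 1 := Real.rpow_lt_one (by norm_num) (by norm_num) (by linarith)
    have hq0 : 0 ≤ q := by positivity
    refine ne_top_of_le_ne_top ((summable_geometric_of_lt_one hq0 hq1).mul_left H).tsum_ofReal_ne_top
      (ENNReal.tsum_le_tsum fun k => ?_)
    have hbound : ∀ i : T k × T' k, ∫⁻ l, ∫⁻ u, ballDeriv ((((((μ.restrict E).prod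
        (ν.restrict F)).map (WithLp.toLp 2)).restrict (prodSet (Metric.closedBall
          (i.1 : EuclideanSpace ℝ (Fin n)) (3 * r k)) (Metric.closedBall
          (i.2 : EuclideanSpace ℝ (Fin p)) (3 * r k)))).map fun z => P l z)) u ^ 2
          ∂volume ∂ω ≤ ENNReal.ofReal (C * (K * K') ^ 2 * (3 * r k) ^ (2 * (s + t) - m)) := by
      intro i
      have h3 : 0 < 3 * r k := by have := hr0 k; positivity
      have h := lintegral_ballDeriv_sq_pushProd_restrict_le ω P (μ.restrict E) (ν.restrict F)
        hK hK' hμ hν (i.1 : EuclideanSpace ℝ (Fin n)) (i.2 : EuclideanSpace ℝ (Fin p)) h3 hL2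
      rw [restrict_prodSet_map_toLp _ _ (hcb _ _) (hcb _ _)]
      simpa only [pushProd_eq_map] using h
    refine (mul_le_mul_right (ENNReal.tsum_le_tsum hbound) _).trans ?_
    rw [tsum_fintype, Finset.sum_const, nsmul_eq_mul, Finset.card_univ, Fintype.card_prod,
      Fintype.card_coe, Fintype.card_coe, ← ENNReal.ofReal_natCast,
      ← ENNReal.ofReal_mul (by positivity), ← ENNReal.ofReal_mul (by positivity)]
    refine ENNReal.ofReal_le_ofReal ?_
    have h0 := hr0 k
    push_cast
    calc (2 ^ k : ℝ) ^ (τ : ℝ) * ((T k).card * (T' k).card *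
          (C * (K * K') ^ 2 * (3 * r k) ^ (2 * (s + t) - m)))
        ≤ (2 ^ k : ℝ) ^ (τ : ℝ) * ((μ.real univ / c * r k ^ (-s)) *
          (ν.real univ / c' * r k ^ (-t)) *
          (C * (K * K') ^ 2 * (3 * r k) ^ (2 * (s + t) - m))) := by
          gcongr
          · exact hTc k
          · exact hTc' k
      _ = C * (K * K') ^ 2 * 3 ^ (2 * (s + t) - m) * (μ.real univ / c) *
          (ν.real univ / c') * (2 ^ k : ℝ) ^ (τ : ℝ) *
          (r k ^ (-s) * r k ^ (-t) * r k ^ (2 * (s + t) - m)) := by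
          rw [Real.mul_rpow (by norm_num) h0.le]; ring
      _ = C * (K * K') ^ 2 * 3 ^ (2 * (s + t) - m) * (μ.real univ / c) *
          (ν.real univ / c') * (2 ^ k : ℝ) ^ (τ : ℝ) * r k ^ (s + t - m) := by
          rw [← Real.rpow_add h0, ← Real.rpow_add h0]
          congr 2; ring
      _ = H * ((2 ^ k : ℝ) ^ (τ : ℝ) * ((1 / 2) ^ k) ^ (s + t - m)) := by
          rw [hH, hr, Real.mul_rpow hr₀0.le (by positivity)]; ring
      _ = H * q ^ k := by
          congr 1
          have h2 : (2 ^ k : ℝ) = ((1 / 2) ^ k)⁻¹ := by rw [one_div, inv_pow, inv_inv]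
          rw [h2, Real.inv_rpow (by positivity), ← Real.rpow_neg (by positivity),
            ← Real.rpow_add (by positivity), hq, ← Real.rpow_natCast, ← Real.rpow_natCast,
            ← Real.rpow_mul (by norm_num), ← Real.rpow_mul (by norm_num)]
          congr 1; ring

theorem ae_le_dimH_slice [IsFiniteMeasure ω]
    (hPm : Measurable fun x : Λ × EuclProd n p => P x.1 x.2) {C : ℝ} (hC : 0 < C)
    (hL2 : ∀ (μ : Measure (EuclideanSpace ℝ (Fin n))) (ν : Measure (EuclideanSpace ℝ (Fin p))),
      IsCompactlySupportedIn μ (Metric.closedBall 0 1) →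
      IsCompactlySupportedIn ν (Metric.closedBall 0 1) →
      IsFrostman μ s → IsFrostman ν t →
      ∫⁻ l, ∫⁻ u, ballDeriv (pushProd (P l) μ ν) u ^ 2 ∂volume ∂ω < ENNReal.ofReal C) :
    ∀ᵐ x ∂(ω.prod (((μ.restrict E).prod (ν.restrict F)).map (WithLp.toLp 2))),
      ENNReal.ofReal (s + t - m) ≤ dimH (prodSet E F ∩ {z | P x.1 z = P x.1 x.2}) := by
  have h : ∀ᵐ x ∂(ω.prod (((μ.restrict E).prod (ν.restrict F)).map (WithLp.toLp 2))), ∀ a : ℚ,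
      0 < (a : ℝ) → (a : ℝ) < s + t - m →
      ENNReal.ofReal a ≤ dimH (prodSet E F ∩ {z | P x.1 z = P x.1 x.2}) := by
    refine ae_all_iff.2 fun a => ?_
    by_cases h1 : 0 < (a : ℝ) ∧ (a : ℝ) < s + t - m
    · filter_upwards [ae_le_dimH_slice_of_lt ω μ ν hE hF hac hPm hC hL2
        (τ := (a : ℝ).toNNReal) (Real.toNNReal_pos.2 h1.1)
        (by rw [Real.coe_toNNReal _ h1.1.le]; exact h1.2)] with x hx _ _ using hx
    · exact Eventually.of_forall fun x h2 h3 => absurd ⟨h2, h3⟩ h1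
  filter_upwards [h] with x hx
  refine ENNReal.le_of_forall_nnreal_lt fun b hb => ?_
  have hb' : (b : ℝ) < s + t - m := by
    rw [← ENNReal.ofReal_coe_nnreal] at hb
    exact (ENNReal.ofReal_lt_ofReal_iff'.1 hb).1
  obtain ⟨a, ha1, ha2⟩ := exists_rat_btwn hb'
  refine le_trans ?_ (hx a (b.2.trans_lt ha1) ha2)
  rw [← ENNReal.ofReal_coe_nnreal]
  exact ENNReal.ofReal_le_ofReal ha1.le

end lower

/-! ### Assembly of the pieces -/

/-- A set of finite `ℋˢ` measure with almost everywhere positive lower density is carried by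
countably many regular pieces, all of whose points have positive lower density. -/
theorem exists_regular_pieces {n : ℕ} {s : ℝ} (hs : 0 < s) {A : Set (EuclideanSpace ℝ (Fin n))}
    (hA : NullMeasurableSet A μH[s]) [IsFiniteMeasure (μH[s].restrict A)]
    (hdens : ∀ᵐ x ∂μH[s], x ∈ A → 0 < lowerDensity s A x) :
    ∃ E : ℕ → Set (EuclideanSpace ℝ (Fin n)),
      (∀ N, IsRegularPiece (μH[s].restrict A) s (E N)) ∧
      (∀ N, E N ⊆ {x ∈ A | 0 < lowerDensity s A x}) ∧
      ∀ᵐ x ∂μH[s].restrict A, ∃ N, x ∈ E N := by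
  set μ := μH[s].restrict A with hμ
  have hgood : ∀ᵐ x ∂μ, x ∈ {x ∈ A | 0 < lowerDensity s A x} := by
    filter_upwards [ae_restrict_of_ae hdens, ae_restrict_mem₀ hA] with x h1 h2 using ⟨h2, h1 h2⟩
  -- Removing a measurable hull of the bad set leaves a Borel set of full measure consisting of good
  -- points; measurability of the lower density is not needed.
  set A₁ := (toMeasurable μ {x ∈ A | 0 < lowerDensity s A x}ᶜ)ᶜ with hA₁
  have hA₁m : MeasurableSet A₁ := (measurableSet_toMeasurable _ _).compl
  have hA₁μ : ∀ᵐ x ∂μ, x ∈ A₁ := by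
    rw [ae_iff]
    simp only [hA₁, mem_compl_iff, not_not, ofPred_mem_eq]
    rw [measure_toMeasurable]
    exact hgood
  have hA₁sub : A₁ ⊆ {x ∈ A | 0 < lowerDensity s A x} :=
    compl_subset_comm.1 (subset_toMeasurable _ _)
  have hup : ∀ᵐ x ∂μ, ∃ N : ℕ, ∀ r : ℝ, 0 < r → r ≤ 1 / ((N : ℝ) + 1) →
      μ (Metric.closedBall x r) ≤ ENNReal.ofReal ((N + 1) * r ^ s) := by
    -- The points of infinite upper density are ℋˢ-null, hence null for μ ≤ ℋˢ.
    have h0 := Measure.absolutelyContinuous_of_le (Measure.restrict_le_self (s := A))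
      (hausdorffMeasure_infinite_upperDensity_eq_zero μ hs)
    filter_upwards [measure_eq_zero_iff_ae_notMem.1 h0] with x hx
    simpa only [mem_ofPred_eq, not_forall, not_exists, not_and, not_lt] using hx
  have hlow : ∀ᵐ x ∂μ, ∃ N : ℕ, ∀ r : ℝ, 0 < r → r ≤ 1 / ((N : ℝ) + 1) →
      ENNReal.ofReal (1 / ((N : ℝ) + 1) * r ^ s) ≤ μ (Metric.closedBall x r) := by
    filter_upwards [hgood] with x hx
    exact exists_le_hausdorffMeasure_of_lowerDensity_pos hs hx.2
  obtain ⟨E, hE, hEA, hEμ⟩ := exists_regular_decomposition μ hs 0 hA₁m hA₁μ hup hlow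
  exact ⟨E, hE, fun N => (hEA N).trans hA₁sub, hEμ⟩

/-- Almost everywhere statements for a product of measures carried by countably many pieces
follow from those for the products of the pieces. -/
theorem ae_prod_prod_of_pieces {n p : ℕ} {Λ : Type*} [MeasurableSpace Λ] (ω : Measure Λ)
    [IsFiniteMeasure ω] (μ : Measure (EuclideanSpace ℝ (Fin n))) [IsFiniteMeasure μ]
    (ν : Measure (EuclideanSpace ℝ (Fin p))) [IsFiniteMeasure ν]
    {E : ℕ → Set (EuclideanSpace ℝ (Fin n))} {F : ℕ → Set (EuclideanSpace ℝ (Fin p))}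
    (hE : ∀ N, MeasurableSet (E N)) (hF : ∀ N, MeasurableSet (F N))
    (hEμ : ∀ᵐ x ∂μ, ∃ N, x ∈ E N) (hFν : ∀ᵐ y ∂ν, ∃ N, y ∈ F N)
    {φ : Λ → EuclProd n p → Prop}
    (h : ∀ N N', ∀ᵐ x ∂(ω.prod (((μ.restrict (E N)).prod (ν.restrict (F N'))).map
      (WithLp.toLp 2))), φ x.1 x.2) :
    ∀ᵐ q ∂((μ.prod ν).prod ω), φ q.2 (WithLp.toLp 2 q.1) := by
  have h1 : ∀ N N', ∀ᵐ q ∂((μ.prod ν).prod ω), q.1 ∈ E N ×ˢ F N' → φ q.2 (WithLp.toLp 2 q.1) := by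
    intro N N'
    have hm := WithLp.measurable_toLp 2 (EuclideanSpace ℝ (Fin n) × EuclideanSpace ℝ (Fin p))
    have h2 := h N N'
    rw [← Measure.map_id (μ := ω), Measure.map_prod_map _ _ measurable_id hm] at h2
    have h3 := ae_of_ae_map (measurable_id.prodMap hm).aemeasurable h2
    have h4 := Measure.measurePreserving_swap.quasiMeasurePreserving.ae h3
    rw [Measure.prod_restrict, ← Measure.restrict_univ (μ := ω), Measure.prod_restrict,
      ae_restrict_iff' (((hE N).prod (hF N')).prod MeasurableSet.univ)] at h4
    filter_upwards [h4] with q hq hqE using hq ⟨hqE, mem_univ _⟩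
  have hE' : ∀ᵐ q ∂((μ.prod ν).prod ω), ∃ N, q.1.1 ∈ E N :=
    (Measure.quasiMeasurePreserving_fst.comp Measure.quasiMeasurePreserving_fst).ae hEμ
  have hF' : ∀ᵐ q ∂((μ.prod ν).prod ω), ∃ N, q.1.2 ∈ F N :=
    (Measure.quasiMeasurePreserving_snd.comp Measure.quasiMeasurePreserving_fst).ae hFν
  filter_upwards [ae_all_iff.2 fun N => ae_all_iff.2 (h1 N), hE', hF'] with q hq hqE hqF
  obtain ⟨N, hN⟩ := hqE
  obtain ⟨N', hN'⟩ := hqF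
  exact hq N N' ⟨hN, hN'⟩

/-- The dimension of the slices of the part of `A × B` of positive density. -/
theorem dimH_slice_posDensityPart {n p m : ℕ} {Λ : Type*} [MetricSpace Λ]
    [MeasurableSpace Λ] [BorelSpace Λ] (ω : Measure Λ) [IsFiniteMeasure ω]
    (P : Λ → EuclProd n p →L[ℝ] EuclideanSpace ℝ (Fin m))
    (hP : ∀ l, IsOrthProj (P l)) (hPcont : ∀ z, Continuous (fun l => P l z))
    {s t : ℝ} (hs : 0 < s) (ht : 0 < t) (hst : (m : ℝ) < s + t)
    (hac : ∀ (μ : Measure (EuclideanSpace ℝ (Fin n))) (ν : Measure (EuclideanSpace ℝ (Fin p))),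
      IsCompactlySupportedIn μ (Metric.closedBall 0 1) →
      IsCompactlySupportedIn ν (Metric.closedBall 0 1) →
      IsFrostman μ s → IsFrostman ν t →
      ∀ᵐ l ∂ω, pushProd (P l) μ ν ≪ volume) {C : ℝ} (hC : 0 < C)
    (hL2 : ∀ (μ : Measure (EuclideanSpace ℝ (Fin n))) (ν : Measure (EuclideanSpace ℝ (Fin p))),
      IsCompactlySupportedIn μ (Metric.closedBall 0 1) →
      IsCompactlySupportedIn ν (Metric.closedBall 0 1) →
      IsFrostman μ s → IsFrostman ν t →
      ∫⁻ l, ∫⁻ u, ballDeriv (pushProd (P l) μ ν) u ^ 2 ∂volume ∂ω < ENNReal.ofReal C)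
    {A : Set (EuclideanSpace ℝ (Fin n))} {B : Set (EuclideanSpace ℝ (Fin p))}
    (hA : NullMeasurableSet A μH[s]) (hA0 : 0 < μH[s] A) (hAtop : μH[s] A < ⊤)
    (hB : NullMeasurableSet B μH[t]) (hB0 : 0 < μH[t] B) (hBtop : μH[t] B < ⊤)
    (hAdens : ∀ᵐ x ∂μH[s], x ∈ A → 0 < lowerDensity s A x)
    (hBdens : ∀ᵐ y ∂μH[t], y ∈ B → 0 < lowerDensity t B y) :
    (∀ᵐ q ∂(((μH[s].restrict A).prod (μH[t].restrict B)).prod ω),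
        dimH (P q.2 ⁻¹' {P q.2 (WithLp.toLp 2 q.1)} ∩ posDensityPart s t A B)
          = ENNReal.ofReal (s + t - m)) ∧
      ∀ᵐ l ∂ω, 0 < volume {u : EuclideanSpace ℝ (Fin m) |
        dimH (P l ⁻¹' {u} ∩ posDensityPart s t A B) = ENNReal.ofReal (s + t - m)} := by
  have : IsFiniteMeasure (μH[s].restrict A) := ⟨by simpa using hAtop⟩
  have : IsFiniteMeasure (μH[t].restrict B) := ⟨by simpa using hBtop⟩
  have hPm := measurable_uncurry_of_isOrthProj hP hPcont
  obtain ⟨E, hE, hEA, hEμ⟩ := exists_regular_pieces hs hA hAdens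
  obtain ⟨F, hF, hFB, hFν⟩ := exists_regular_pieces ht hB hBdens
  set μ := μH[s].restrict A with hμ
  set ν := μH[t].restrict B with hν
  have hacp := fun N N' => ae_map_absolutelyContinuous_of_isRegularPiece ω μ ν (hE N) (hF N') hac
  have hpiece : ∀ N N', ∀ᵐ x ∂(ω.prod (((μ.restrict (E N)).prod (ν.restrict (F N'))).map
      (WithLp.toLp 2))), dimH (P x.1 ⁻¹' {P x.1 x.2} ∩ posDensityPart s t A B)
        = ENNReal.ofReal (s + t - m) := by
    intro N N'
    have hup : ∀ᵐ x ∂(ω.prod (((μ.restrict (E N)).prod (ν.restrict (F N'))).map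
        (WithLp.toLp 2))), dimH (P x.1 ⁻¹' {P x.1 x.2} ∩ posDensityPart s t A B)
          ≤ ENNReal.ofReal (s + t - m) := by
      have h1 := ae_dimH_slice_posDensityPart_le ω hP (fun z => (hPcont z).measurable) hs ht hst
        hAtop hBtop
      -- The upper bound holds for almost all (l, u); absolute continuity of the law of (l, P_l z)
      -- transfers it to almost all (l, z).
      have h2 : (ω.prod (((μ.restrict (E N)).prod (ν.restrict (F N'))).map (WithLp.toLp 2))).map
          (fun x => (x.1, P x.1 x.2)) ≪ ω.prod volume := by
        rw [map_prodMk_eq_withDensity_sliceDensity ω hPm _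
        (hacp N N')]
        exact withDensity_absolutelyContinuous _ _
      exact ae_of_ae_map (measurable_fst.prodMk hPm).aemeasurable (h2.ae_le h1)
    filter_upwards [hup, ae_le_dimH_slice ω μ ν (hE N) (hF N') hac hPm hC hL2] with x h1 h2
    refine le_antisymm h1 (h2.trans (dimH_mono ?_))
    rintro z ⟨⟨hzE, hzF⟩, hz⟩
    exact ⟨hz, ⟨(hEA N hzE).1, (hFB N' hzF).1⟩, Or.inl (hEA N hzE).2⟩
  refine ⟨ae_prod_prod_of_pieces ω μ ν (fun N => (hE N).measurableSet)
    (fun N => (hF N).measurableSet) hEμ hFν (φ := fun l z =>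
      dimH (P l ⁻¹' {P l z} ∩ posDensityPart s t A B) = ENNReal.ofReal (s + t - m)) hpiece, ?_⟩
  have hne : ∀ {k : ℕ} (κ : Measure (EuclideanSpace ℝ (Fin k)))
      (D : ℕ → Set (EuclideanSpace ℝ (Fin k))), κ univ ≠ 0 → (∀ᵐ x ∂κ, ∃ N, x ∈ D N) →
      ∃ N, κ (D N) ≠ 0 := by
    intro k κ D hκ h
    by_contra! hcon
    refine hκ (measure_mono_null (t := {x | ¬ ∃ N, x ∈ D N} ∪ ⋃ N, D N) (fun x _ => ?_)
      (measure_union_null h (measure_iUnion_null hcon)))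
    by_cases hx : ∃ N, x ∈ D N
    · exact Or.inr (mem_iUnion.2 hx)
    · exact Or.inl hx
  -- A single pair of pieces of positive measure suffices for the statement about u.
  obtain ⟨N, hN⟩ := hne μ E (by simpa [hμ] using hA0.ne') hEμ
  obtain ⟨N', hN'⟩ := hne ν F (by simpa [hν] using hB0.ne') hFν
  filter_upwards [Measure.ae_ae_of_ae_prod (hpiece N N'), hacp N N'] with l hl hlac
  rw [pos_iff_ne_zero]
  -- If the good u formed a null set, absolute continuity would make its preimage null, while almost
  -- every z of the non-zero product measure lies in it.
  intro h0
  have h1 := ae_of_ae_map (P l).continuous.measurable.aemeasurable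
    (measure_eq_zero_iff_ae_notMem.1 (hlac h0))
  have h2 : ∀ᵐ z ∂(((μ.restrict (E N)).prod (ν.restrict (F N'))).map (WithLp.toLp 2) :
      Measure (EuclProd n p)), False := by
    filter_upwards [hl, h1] with z hz hz' using hz' hz
  rw [ae_iff] at h2
  simp only [not_false_eq_true, ofPred_true] at h2
  rw [Measure.map_apply (WithLp.measurable_toLp 2 _) MeasurableSet.univ, preimage_univ,
    ← univ_prod_univ, Measure.prod_prod, Measure.restrict_apply_univ,
    Measure.restrict_apply_univ] at h2
  exact (mul_ne_zero hN hN') h2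

theorem mainTheorem2 {n p m : ℕ} {Λ : Type*} [MetricSpace Λ] [CompactSpace Λ]
    [MeasurableSpace Λ] [BorelSpace Λ] (ω : Measure Λ) [IsFiniteMeasure ω] (hω : ω ≠ 0)
    (P : Λ → EuclProd n p →L[ℝ] EuclideanSpace ℝ (Fin m))
    (hP : ∀ l, IsOrthProj (P l))
    (hPcont : ∀ z, Continuous (fun l => P l z))
    (s t : ℝ) (hs : 0 < s) (ht : 0 < t) (hst : (m : ℝ) < s + t)
    (hac : ∀ (μ : Measure (EuclideanSpace ℝ (Fin n))) (ν : Measure (EuclideanSpace ℝ (Fin p))),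
      IsCompactlySupportedIn μ (Metric.closedBall 0 1) →
      IsCompactlySupportedIn ν (Metric.closedBall 0 1) →
      IsFrostman μ s → IsFrostman ν t →
      ∀ᵐ l ∂ω, pushProd (P l) μ ν ≪ volume)
    (hL2 : ∃ C : ℝ, 0 < C ∧
      ∀ (μ : Measure (EuclideanSpace ℝ (Fin n))) (ν : Measure (EuclideanSpace ℝ (Fin p))),
      IsCompactlySupportedIn μ (Metric.closedBall 0 1) →
      IsCompactlySupportedIn ν (Metric.closedBall 0 1) →
      IsFrostman μ s → IsFrostman ν t →
      ∫⁻ l, ∫⁻ u, ballDeriv (pushProd (P l) μ ν) u ^ 2 ∂volume ∂ω < ENNReal.ofReal C)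
    (A : Set (EuclideanSpace ℝ (Fin n))) (B : Set (EuclideanSpace ℝ (Fin p)))
    (hA : NullMeasurableSet A μH[s]) (hA0 : 0 < μH[s] A) (hAtop : μH[s] A < ⊤)
    (hB : NullMeasurableSet B μH[t]) (hB0 : 0 < μH[t] B) (hBtop : μH[t] B < ⊤)
    (hAdens : ∀ᵐ x ∂μH[s], x ∈ A → 0 < lowerDensity s A x)
    (hBdens : ∀ᵐ y ∂μH[t], y ∈ B → 0 < lowerDensity t B y) :
    -- both formulas for the part of `A × B` with positive density, which has full measure
    ((∀ᵐ q ∂(((μH[s].restrict A).prod (μH[t].restrict B)).prod ω),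
        dimH (P q.2 ⁻¹' {P q.2 (WithLp.toLp 2 q.1)} ∩ posDensityPart s t A B)
          = ENNReal.ofReal (s + t - m)) ∧
      (∀ᵐ l ∂ω, 0 < volume {u : EuclideanSpace ℝ (Fin m) |
        dimH (P l ⁻¹' {u} ∩ posDensityPart s t A B) = ENNReal.ofReal (s + t - m)})) ∧
    -- both lower bounds for all of `A × B`
    ((∀ᵐ q ∂(((μH[s].restrict A).prod (μH[t].restrict B)).prod ω),
        ENNReal.ofReal (s + t - m)
          ≤ dimH (P q.2 ⁻¹' {P q.2 (WithLp.toLp 2 q.1)} ∩ prodSet A B)) ∧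
      (∀ᵐ l ∂ω, 0 < volume {u : EuclideanSpace ℝ (Fin m) |
        ENNReal.ofReal (s + t - m) ≤ dimH (P l ⁻¹' {u} ∩ prodSet A B)})) ∧
    -- both formulas for `A × B`, if `A` or `B` has positive lower density at each of its points
    (((∀ x ∈ A, 0 < lowerDensity s A x) ∨ (∀ y ∈ B, 0 < lowerDensity t B y)) →
      (∀ᵐ q ∂(((μH[s].restrict A).prod (μH[t].restrict B)).prod ω),
        dimH (P q.2 ⁻¹' {P q.2 (WithLp.toLp 2 q.1)} ∩ prodSet A B)
          = ENNReal.ofReal (s + t - m)) ∧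
      (∀ᵐ l ∂ω, 0 < volume {u : EuclideanSpace ℝ (Fin m) |
        dimH (P l ⁻¹' {u} ∩ prodSet A B) = ENNReal.ofReal (s + t - m)})) := by
  obtain ⟨C, hC, hL2⟩ := hL2
  have h := dimH_slice_posDensityPart ω P hP hPcont hs ht hst hac hC hL2 hA hA0 hAtop hB hB0 hBtop
    hAdens hBdens
  refine ⟨h, ⟨?_, ?_⟩, fun hpos => ?_⟩
  -- Passing from the positive-density part to all of A × B keeps only the lower bound: the covering
  -- argument says nothing about the remaining points.
  · filter_upwards [h.1] with q hq
    exact hq.ge.trans (dimH_mono (inter_subset_inter_right _ fun z hz => hz.1))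
  · filter_upwards [h.2] with l hl
    refine hl.trans_le (measure_mono fun u hu => ?_)
    exact (show dimH _ = _ from hu).ge.trans
      (dimH_mono (inter_subset_inter_right _ fun z hz => hz.1))
  · have hG : posDensityPart s t A B = prodSet A B :=
      Subset.antisymm (fun z hz => hz.1) fun z hz =>
        ⟨hz, hpos.imp (fun h => h _ hz.1) fun h => h _ hz.2⟩
    rwa [hG] at h
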